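/- All graphs are finite, simple, undirected and connected. For a graph $G=(V,E)$ let $n=|V|$. The monophonic interval $I_m(u,v)$ of $u,v\in V$ is the set of all vertices that lie on an induced path between $u$ and $v$. A set $S\subseteq V$ is m-convex if $I_m(u,v)\subseteq S$ for all $u,v\in S$, and $H\subseteq V$ is an m-halfspace of $G$ if both $H$ and $V\setminus H$ are m-convex. Let $\mathcal H_m(G)$ be the family of all m-halfspaces of $G$ and let $d$ be its VC-dimension. In online learning of m-halfspaces the learner is given $G$ (but not $d$), while a target $H\in\mathcal H_m(G)$ is fixed and unknown to it. In each round a vertex $v\in V$ is presented, the learner predicts whether $v\in H$, and then it is told the correct answer; a wrong prediction is a mistake. The number of rounds is arbitrary and the mistakes are counted over all rounds, in the worst case over the targets and over the sequences of vertices. The running time is that of a deterministic random access machine with logarithmic cost (which starts with the adjacency matrix of $G$ in its memory); a time bound $\tau$ means that the preprocessing of $G$ takes time at most $\tau$ and that each round takes time at most $\tau$. **Theorem.** (1) There is an online learning algorithm that, on every connected graph $G$ with $n\ge 2$ vertices, learns the m-halfspaces of $G$ in time $\mathrm{poly}(n)$ with $\mathcal O(d\log n)$ mistakes. (2) There is an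 online learning algorithm that, on every connected graph $G$ with $n\ge 1$ vertices, learns the m-halfspaces of $G$ in time $2^d\,\mathrm{poly}(n)$ with $\mathcal O(d+\log n)$ mistakes. In both parts the algorithm, the polynomial and the constant hidden in $\mathcal O(\cdot)$ are absolute, i.e. independent of $G$, $H$ and the sequence of vertices. -/

import Mathlib

namespace MonoHalfspace

/-! ### Monophonic halfspaces -/

/-- The monophonic interval `I_m(u, v)`: all vertices lying on an induced `u`-`v` path, i.e. on a path
two of whose vertices are adjacent only if they are joined by an edge of the path. -/
def mInterval {V : Type*} (G : SimpleGraph V) (u v : V) : Set V :=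
  {x | ∃ p : G.Walk u v, p.IsPath ∧ p.IsChordless ∧ x ∈ p.support}

/-- A set of vertices is m-convex if it contains the monophonic interval of any two of its elements. -/
def IsMConvex {V : Type*} (G : SimpleGraph V) (S : Set V) : Prop :=
  ∀ u ∈ S, ∀ v ∈ S, mInterval G u v ⊆ S

open Classical in
/-- The family `H_m(G)` of all m-halfspaces: the m-convex sets whose complement is m-convex. -/
noncomputable def mHalfspaces {V : Type*} [Fintype V] (G : SimpleGraph V) : Finset (Finset V) :=
  Finset.univ.filter fun H => IsMConvex G (H : Set V) ∧ IsMConvex G (H : Set V)ᶜ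

/-! ### The machine model: a random access machine with the logarithmic cost criterion

A program uses finitely many registers and finitely many one-dimensional arrays. All cells hold natural
numbers. Every elementary operation is charged one unit plus the bit lengths of all the numbers
(operands, addresses and contents of cells) it handles. -/

/-- A memory: the contents `reg x` of register `x`, and the entry `arr a i` of array `a` at address `i`. -/
structure Memory where
  reg : ℕ → ℕ
  arr : ℕ → ℕ → ℕ

/-- Store the value `k` in register `x`. -/
def Memory.setReg (s : Memory) (x k : ℕ) : Memory :=
  { s with reg := Function.update s.reg x k }

/-- Store the value `k` in array `a` at address `i`. -/
def Memory.setArr (s : Memory) (a i k : ℕ) : Memory :=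
  { s with arr := Function.update s.arr a (Function.update (s.arr a) i k) }

/-- Arithmetic expressions. -/
inductive Expr where
  | lit (k : ℕ)
  | reg (x : ℕ)
  | get (a : ℕ) (i : Expr)
  | add (e f : Expr)
  | sub (e f : Expr)
  | mul (e f : Expr)
  | div (e f : Expr)

/-- The value of an expression; `sub` is truncated at zero and `div` is division with rounding down. -/
def Expr.eval (s : Memory) : Expr → ℕ
  | .lit k => k
  | .reg x => s.reg x
  | .get a i => s.arr a (i.eval s)
  | .add e f => e.eval s + f.eval s
  | .sub e f => e.eval s - f.eval s
  | .mul e f => e.eval s * f.eval s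
  | .div e f => e.eval s / f.eval s

/-- The logarithmic cost of evaluating an expression; `Nat.size` is the bit length. -/
def Expr.cost (s : Memory) : Expr → ℕ
  | .lit k => 1 + k.size
  | .reg x => 1 + (s.reg x).size
  | .get a i => i.cost s + (1 + (i.eval s).size + (s.arr a (i.eval s)).size)
  | .add e f => e.cost s + f.cost s + (1 + (e.eval s).size + (f.eval s).size)
  | .sub e f => e.cost s + f.cost s + (1 + (e.eval s).size + (f.eval s).size)
  | .mul e f => e.cost s + f.cost s + (1 + (e.eval s).size + (f.eval s).size)
  | .div e f => e.cost s + f.cost s + (1 + (e.eval s).size + (f.eval s).size)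

/-- Programs. A test counts as true when the value of its expression is nonzero. -/
inductive Prog where
  | skip
  | assign (x : ℕ) (e : Expr)
  | put (a : ℕ) (i e : Expr)
  | seq (P Q : Prog)
  | branch (e : Expr) (P Q : Prog)
  | loop (e : Expr) (P : Prog)

/-- `Exec P s s' t`: started in memory `s`, the program `P` halts in memory `s'` after time `t`. -/
inductive Exec : Prog → Memory → Memory → ℕ → Prop where
  | skip (s : Memory) : Exec .skip s s 1
  | assign (s : Memory) (x : ℕ) (e : Expr) :
      Exec (.assign x e) s (s.setReg x (e.eval s)) (e.cost s + (1 + (e.eval s).size))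
  | put (s : Memory) (a : ℕ) (i e : Expr) :
      Exec (.put a i e) s (s.setArr a (i.eval s) (e.eval s))
        (i.cost s + e.cost s + (1 + (i.eval s).size + (e.eval s).size))
  | seq {P Q : Prog} {s s' s'' : Memory} {t t' : ℕ} :
      Exec P s s' t → Exec Q s' s'' t' → Exec (.seq P Q) s s'' (t + t')
  | branch_true {e : Expr} {P Q : Prog} {s s' : Memory} {t : ℕ} :
      e.eval s ≠ 0 → Exec P s s' t → Exec (.branch e P Q) s s' (e.cost s + 1 + t)
  | branch_false {e : Expr} {P Q : Prog} {s s' : Memory} {t : ℕ} :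
      e.eval s = 0 → Exec Q s s' t → Exec (.branch e P Q) s s' (e.cost s + 1 + t)
  | loop_true {e : Expr} {P : Prog} {s s' s'' : Memory} {t t' : ℕ} :
      e.eval s ≠ 0 → Exec P s s' t → Exec (.loop e P) s' s'' t' →
      Exec (.loop e P) s s'' (e.cost s + 1 + t + t')
  | loop_false {e : Expr} {P : Prog} {s : Memory} :
      e.eval s = 0 → Exec (.loop e P) s s (e.cost s + 1)

/-- The machine is deterministic. -/
theorem Exec.deterministic {P : Prog} {s s₁ s₂ : Memory} {t₁ t₂ : ℕ}
    (h₁ : Exec P s s₁ t₁) (h₂ : Exec P s s₂ t₂) : s₁ = s₂ ∧ t₁ = t₂ := by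
  induction h₁ generalizing s₂ t₂ with
  | skip s => cases h₂; exact ⟨rfl, rfl⟩
  | assign s x e => cases h₂; exact ⟨rfl, rfl⟩
  | put s a i e => cases h₂; exact ⟨rfl, rfl⟩
  | seq _ _ ihP ihQ =>
    cases h₂ with
    | seq hP hQ =>
      obtain ⟨rfl, rfl⟩ := ihP hP
      obtain ⟨rfl, rfl⟩ := ihQ hQ
      exact ⟨rfl, rfl⟩
  | branch_true he _ ih =>
    cases h₂ with
    | branch_true _ hP => obtain ⟨rfl, rfl⟩ := ih hP; exact ⟨rfl, rfl⟩
    | branch_false he' _ => exact absurd he' he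
  | branch_false he _ ih =>
    cases h₂ with
    | branch_true he' _ => exact absurd he he'
    | branch_false _ hQ => obtain ⟨rfl, rfl⟩ := ih hQ; exact ⟨rfl, rfl⟩
  | loop_true he _ _ ihP ihL =>
    cases h₂ with
    | loop_true _ hP hL =>
      obtain ⟨rfl, rfl⟩ := ihP hP
      obtain ⟨rfl, rfl⟩ := ihL hL
      exact ⟨rfl, rfl⟩
    | loop_false he' => exact absurd he' he
  | loop_false he =>
    cases h₂ with
    | loop_true he' _ _ => exact absurd he he'
    | loop_false _ => exact ⟨rfl, rfl⟩

/-! ### Online learning -/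

open Classical in
/-- The input memory for a graph on the vertices `0, …, n - 1`: register `0` holds `n`, and array `0`
holds the adjacency matrix, row by row. Everything else is zero. -/
noncomputable def inputMemory {n : ℕ} (G : SimpleGraph (Fin n)) : Memory where
  reg := Function.update (fun _ => 0) 0 n
  arr := Function.update (fun _ _ => 0) 0
    fun k => if ∃ i j : Fin n, G.Adj i j ∧ k = (i : ℕ) * n + (j : ℕ) then 1 else 0

/-- An online learning algorithm. It works on one memory that persists over all rounds: `setup` is run
once on the input graph; in each round the number of the vertex is put in register `1` and `predict` is
run, which leaves the predicted label in register `2` (nonzero for membership); then the true label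
(`1` or `0`) is put in register `3` and `update` is run. -/
structure OnlineLearner where
  setup : Prog
  predict : Prog
  update : Prog

/-- The label that the target `H` gives to the vertex `v`. -/
def label {n : ℕ} (H : Finset (Fin n)) (v : Fin n) : ℕ := if v ∈ H then 1 else 0

/-- `A.Run G H τ vs s k`: the learner `A`, given the graph `G` and then the sequence `vs` of vertices,
labelled by `H`, reaches the memory `s` after having made exactly `k` mistakes, and it has spent at most
time `τ` on the setup and at most time `τ` on each round. -/
inductive OnlineLearner.Run (A : OnlineLearner) {n : ℕ} (G : SimpleGraph (Fin n))
    (H : Finset (Fin n)) (τ : ℕ) : List (Fin n) → Memory → ℕ → Prop where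
  | start {s : Memory} {t : ℕ} :
      Exec A.setup (inputMemory G) s t → t ≤ τ → A.Run G H τ [] s 0
  | round {vs : List (Fin n)} {s s' s'' : Memory} {k t t' : ℕ} (v : Fin n) :
      A.Run G H τ vs s k →
      Exec A.predict (s.setReg 1 (v : ℕ)) s' t →
      Exec A.update (s'.setReg 3 (label H v)) s'' t' →
      t + t' ≤ τ →
      A.Run G H τ (vs ++ [v]) s'' (k + if (s'.reg 2 ≠ 0 ↔ v ∈ H) then 0 else 1)

/-- The learner `A` learns the m-halfspaces of `G` online in time `τ` (for the setup, and for each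
round) with at most `M` mistakes: this holds for every target m-halfspace and every finite sequence
of vertices labelled by it. -/
def OnlineLearner.LearnsHalfspaces (A : OnlineLearner) {n : ℕ} (G : SimpleGraph (Fin n))
    (τ : ℕ) (M : ℝ) : Prop :=
  ∀ H ∈ mHalfspaces G, ∀ vs : List (Fin n), ∃ (s : Memory) (k : ℕ), A.Run G H τ vs s k ∧ (k : ℝ) ≤ M

end MonoHalfspace

/-!
In a connected graph, the m-halfspaces are the sides of the cuts whose two borders are cliques
(`mem_mHalfspaces_iff`). Hence, if `u v` and `u' v'` are edges and `u ≠ u'` are not adjacent, it is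
impossible that `u` and `u'` are on one side while `v` and `v'` are on the other one. Labels that are known
can be propagated by this rule and two variants of it (`HalfClosed`).

Fix a cut edge `a b` of the target `H`. Once `a` and `b` are labelled, propagation labels every
vertex that is adjacent to exactly one of them. The other vertices are common neighbours of `a` and `b`,
or far from both. An edge at a far vertex is never cut, and two common neighbours that are not adjacent are
always separated; these ties (`Tied`) group the vertices into classes, and one label in a class determines
the whole class by propagation. The neighbourhoods of the common neighbours of `a` and `b` among the
vertices adjacent to only one of `a`, `b` (`profile`) are monotone along the cut. Therefore two more vertices
labelled in advance, extremal on the two sides, force all common neighbours that remain unknown on the same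
side to have equal profiles (`CutEdge.exists_guess`). Then the labels of an unknown vertex of `H` and its
class can be reversed independently of the other classes, and the result is a halfspace again
(`Flippable.cliqueCut`, `CutEdge.exists_flip`). Representatives of different classes are thus shattered, and
at most `d` classes of vertices of `H` remain unknown (`exists_good_vertices`).

An expert guesses four vertices with their labels, adds the labels seen so far, propagates, and predicts a
default label for the vertices that remain unlabelled. Guessing the right vertices and predicting
non-membership by default leads to at most `d` mistakes, since a mistake reveals the label of a whole class
(`exists_goodExpert`). The weighted majority vote over `2 n ^ 4` experts, with weights halved after mistakes,
then makes `O(d + log n)` mistakes: each mistake of the vote reduces the total weight to at most `3 / 4`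
of it, whereas the good expert keeps at least the fraction `2 ^ (-d)` of its weight (`Invariant`,
`mistakes_le`). The initial weights are `2 ^ n`, which stays integral when it is halved at most `n` times.

The vote is computed by a program all of whose loops are counting loops up to `n` or `n ^ 4` and whose
products have the factor `n`. For such tame programs the bit lengths grow by a polynomial amount and
the logarithmic cost is polynomial (`Code.Tame.exec`); between two rounds, the bit lengths do not grow.

So one learner with polynomial running time and `O(d + log n)` mistakes serves both claims. For the first one,
`d ≥ 1` (`one_le_vcDim`) and `log n ≥ log 2` turn the sum into a product.
-/

namespace MonoHalfspace

/-! ### Structured programs: total semantics and automatic polynomial running time -/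

/-- An expression is *linear* if one factor of every product is register `0`, which holds the number
of vertices. The values of linear expressions have polynomially growing bit length. -/
def Expr.Linear : Expr → Prop
  | .lit _ => True
  | .reg _ => True
  | .get _ i => i.Linear
  | .add e f => e.Linear ∧ f.Linear
  | .sub e f => e.Linear ∧ f.Linear
  | .mul e f => e.Linear ∧ f = .reg 0
  | .div e f => e.Linear ∧ f.Linear

/-- A bound, in terms of the content `n` of register `0`, both for the number of elementary steps in the
evaluation of a linear expression and for the growth in bit length that it causes. -/
def Expr.weight (n : ℕ) : Expr → ℕ
  | .lit k => 1 + k.size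
  | .reg _ => 1
  | .get _ i => i.weight n + 1
  | .add e f => e.weight n + f.weight n + 1
  | .sub e f => e.weight n + f.weight n + 1
  | .mul e f => e.weight n + f.weight n + n + 1
  | .div e f => e.weight n + f.weight n + 1

/-- Every cell of the memory holds a number of at most `b` bits. -/
def Memory.Bounded (s : Memory) (b : ℕ) : Prop :=
  (∀ x, s.reg x < 2 ^ b) ∧ ∀ a i, s.arr a i < 2 ^ b

theorem Memory.Bounded.mono {s : Memory} {b c : ℕ} (h : s.Bounded b) (hbc : b ≤ c) : s.Bounded c :=
  ⟨fun x => (h.1 x).trans_le (Nat.pow_le_pow_right two_pos hbc),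
    fun a i => (h.2 a i).trans_le (Nat.pow_le_pow_right two_pos hbc)⟩

theorem Memory.Bounded.setReg {s : Memory} {b : ℕ} (h : s.Bounded b) {x k : ℕ} (hk : k < 2 ^ b) :
    (s.setReg x k).Bounded b := by
  refine ⟨fun y => ?_, h.2⟩
  by_cases hy : y = x
  · subst hy; simpa [Memory.setReg] using hk
  · simpa [Memory.setReg, hy] using h.1 y

theorem Memory.Bounded.setArr {s : Memory} {b : ℕ} (h : s.Bounded b) {a i k : ℕ} (hk : k < 2 ^ b) :
    (s.setArr a i k).Bounded b := by
  refine ⟨h.1, fun a' j => ?_⟩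
  by_cases ha : a' = a
  · subst ha
    by_cases hj : j = i
    · subst hj; simpa [Memory.setArr] using hk
    · simpa [Memory.setArr, hj] using h.2 a' j
  · simpa [Memory.setArr, ha] using h.2 a' j

theorem Expr.eval_lt {n b : ℕ} {s : Memory} (h0 : s.reg 0 = n) (hs : s.Bounded b) :
    ∀ e : Expr, e.Linear → e.eval s < 2 ^ (b + e.weight n)
  | .lit k, _ => (Nat.lt_size_self k).trans_le
      (Nat.pow_le_pow_right two_pos (by simp only [Expr.weight]; omega))
  | .reg x, _ => (hs.1 x).trans_le (Nat.pow_le_pow_right two_pos (by simp only [Expr.weight]; omega))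
  | .get a i, _ =>
    (hs.2 a _).trans_le (Nat.pow_le_pow_right two_pos (by simp only [Expr.weight]; omega))
  | .add e f, h => by
    have he := Expr.eval_lt h0 hs e h.1
    have hf := Expr.eval_lt h0 hs f h.2
    have he' : 2 ^ (b + e.weight n) ≤ 2 ^ (b + e.weight n + f.weight n) :=
      Nat.pow_le_pow_right two_pos (by omega)
    have hf' : 2 ^ (b + f.weight n) ≤ 2 ^ (b + e.weight n + f.weight n) :=
      Nat.pow_le_pow_right two_pos (by omega)
    have : 2 ^ (b + (Expr.add e f).weight n) = 2 * 2 ^ (b + e.weight n + f.weight n) := by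
      simp only [Expr.weight]; ring
    simp only [Expr.eval]; omega
  | .sub e f, h => ((Nat.sub_le _ _).trans_lt (Expr.eval_lt h0 hs e h.1)).trans_le
      (Nat.pow_le_pow_right two_pos (by simp only [Expr.weight]; omega))
  | .mul e f, h => by
    have he := Expr.eval_lt h0 hs e h.1
    obtain ⟨-, rfl⟩ := h
    have hn : n < 2 ^ n := Nat.lt_two_pow_self
    calc e.eval s * s.reg 0 < 2 ^ (b + e.weight n) * 2 ^ n := by
          rw [h0]; exact Nat.mul_lt_mul_of_lt_of_lt he hn
      _ = 2 ^ (b + e.weight n + n) := by ring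
      _ ≤ _ := Nat.pow_le_pow_right two_pos (by simp only [Expr.weight]; omega)
  | .div e f, h => ((Nat.div_le_self _ _).trans_lt (Expr.eval_lt h0 hs e h.1)).trans_le
      (Nat.pow_le_pow_right two_pos (by simp only [Expr.weight]; omega))

theorem Expr.cost_le {n b c : ℕ} {s : Memory} (h0 : s.reg 0 = n) (hs : s.Bounded b) :
    ∀ e : Expr, e.Linear → b + e.weight n ≤ c → e.cost s ≤ e.weight n * (2 * c + 1) := by
  have key : ∀ e : Expr, e.Linear → b + e.weight n ≤ c → (e.eval s).size ≤ c := fun e he hc =>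
    Nat.size_le.2 ((Expr.eval_lt h0 hs e he).trans_le (Nat.pow_le_pow_right two_pos hc))
  have hreg : ∀ x, (s.reg x).size ≤ b := fun x => Nat.size_le.2 (hs.1 x)
  have harr : ∀ a i, (s.arr a i).size ≤ b := fun a i => Nat.size_le.2 (hs.2 a i)
  intro e
  induction e with
  | lit k => intro _ hc; simp only [Expr.weight, Expr.cost] at *; nlinarith
  | reg x => intro _ hc; have := hreg x; simp only [Expr.weight, Expr.cost] at *; omega
  | get a i ih =>
    intro h hc
    simp only [Expr.weight] at hc
    have h1 := ih h (by omega)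
    have h2 := key i h (by omega)
    have h3 := harr a (i.eval s)
    simp only [Expr.weight, Expr.cost, add_mul, one_mul]; omega
  | add e f ihe ihf =>
    intro h hc
    simp only [Expr.weight] at hc
    have h1 := ihe h.1 (by omega)
    have h2 := ihf h.2 (by omega)
    have h3 := key e h.1 (by omega)
    have h4 := key f h.2 (by omega)
    simp only [Expr.weight, Expr.cost, add_mul, one_mul]; omega
  | sub e f ihe ihf =>
    intro h hc
    simp only [Expr.weight] at hc
    have h1 := ihe h.1 (by omega)
    have h2 := ihf h.2 (by omega)
    have h3 := key e h.1 (by omega)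
    have h4 := key f h.2 (by omega)
    simp only [Expr.weight, Expr.cost, add_mul, one_mul]; omega
  | div e f ihe ihf =>
    intro h hc
    simp only [Expr.weight] at hc
    have h1 := ihe h.1 (by omega)
    have h2 := ihf h.2 (by omega)
    have h3 := key e h.1 (by omega)
    have h4 := key f h.2 (by omega)
    simp only [Expr.weight, Expr.cost, add_mul, one_mul]; omega
  | mul e f ihe ihf =>
    intro h hc
    have hf : f.Linear := by rw [h.2]; trivial
    simp only [Expr.weight] at hc
    have h1 := ihe h.1 (by omega)
    have h2 := ihf hf (by omega)
    have h3 := key e h.1 (by omega)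
    have h4 := key f hf (by omega)
    have h5 : 0 ≤ n * (2 * c + 1) := Nat.zero_le _
    simp only [Expr.weight, Expr.cost, add_mul, one_mul]; omega

theorem Expr.exists_weight_le (e : Expr) :
    ∃ p : Polynomial ℕ, ∀ n, e.weight n ≤ p.eval n := by
  induction e with
  | lit k => exact ⟨Polynomial.C (1 + k.size), fun n => by simp [Expr.weight]⟩
  | reg x => exact ⟨1, fun n => by simp [Expr.weight]⟩
  | get a i ih => obtain ⟨p, hp⟩ := ih; exact ⟨p + 1, fun n => by simp [Expr.weight, hp n]⟩
  | add e f ihe ihf | sub e f ihe ihf | div e f ihe ihf =>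
    obtain ⟨p, hp⟩ := ihe; obtain ⟨q, hq⟩ := ihf
    exact ⟨p + q + 1, fun n => by have := hp n; have := hq n; simp [Expr.weight]; omega⟩
  | mul e f ihe ihf =>
    obtain ⟨p, hp⟩ := ihe; obtain ⟨q, hq⟩ := ihf
    exact ⟨p + q + Polynomial.X + 1, fun n => by
      have := hp n; have := hq n; simp [Expr.weight]; omega⟩

/-- Structured programs. The only loops are counting loops: `loop x y P` runs `P` with register `x`
counting from zero up to the content of register `y`. -/
inductive Code where
  | skip
  | assign (x : ℕ) (e : Expr)
  | put (a : ℕ) (i e : Expr)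
  | seq (P Q : Code)
  | ite (e : Expr) (P Q : Code)
  | loop (x y : ℕ) (P : Code)

/-- The program of the machine that a structured program stands for. -/
def Code.compile : Code → Prog
  | .skip => .skip
  | .assign x e => .assign x e
  | .put a i e => .put a i e
  | .seq P Q => .seq P.compile Q.compile
  | .ite e P Q => .branch e P.compile Q.compile
  | .loop x y P => .seq (.assign x (.lit 0))
      (.loop (.sub (.reg y) (.reg x)) (.seq P.compile (.assign x (.add (.reg x) (.lit 1)))))

/-- The memory in which a structured program ends. -/
def Code.run : Code → Memory → Memory
  | .skip, s => s
  | .assign x e, s => s.setReg x (e.eval s)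
  | .put a i e, s => s.setArr a (i.eval s) (e.eval s)
  | .seq P Q, s => Q.run (P.run s)
  | .ite e P Q, s => if e.eval s ≠ 0 then P.run s else Q.run s
  | .loop x y P, s =>
    (fun s => (P.run s).setReg x ((P.run s).reg x + 1))^[s.reg y] (s.setReg x 0)

/-- Whether a structured program may write to register `x`. -/
def Code.writesReg (x : ℕ) : Code → Bool
  | .skip => false
  | .assign y _ => x == y
  | .put _ _ _ => false
  | .seq P Q => P.writesReg x || Q.writesReg x
  | .ite _ P Q => P.writesReg x || Q.writesReg x
  | .loop y _ P => x == y || P.writesReg x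

/-- Whether a structured program may write to array `a`. -/
def Code.writesArr (a : ℕ) : Code → Bool
  | .skip => false
  | .assign _ _ => false
  | .put b _ _ => a == b
  | .seq P Q => P.writesArr a || Q.writesArr a
  | .ite _ P Q => P.writesArr a || Q.writesArr a
  | .loop _ _ P => P.writesArr a

/-- A structured program is *tame* if its expressions are linear, every loop is bounded by register `0`
or register `4` (which hold `n` and `n ^ 4`), and neither these two registers nor a running loop counter
is written to. -/
def Code.Tame : Code → Prop
  | .skip => True
  | .assign x e => x ≠ 0 ∧ x ≠ 4 ∧ e.Linear
  | .put _ i e => i.Linear ∧ e.Linear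
  | .seq P Q => P.Tame ∧ Q.Tame
  | .ite e P Q => e.Linear ∧ P.Tame ∧ Q.Tame
  | .loop x y P => x ≠ 0 ∧ x ≠ 4 ∧ (y = 0 ∨ y = 4) ∧ P.writesReg x = false ∧ P.Tame

/-- A bound for the number of elementary steps of a tame program. -/
def Code.steps (n : ℕ) : Code → ℕ
  | .skip => 1
  | .assign _ e => e.weight n + 1
  | .put _ i e => i.weight n + e.weight n + 1
  | .seq P Q => P.steps n + Q.steps n
  | .ite e P Q => e.weight n + P.steps n + Q.steps n + 1
  | .loop _ y P => (if y = 0 then n else n ^ 4) * (P.steps n + 10) + 10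

theorem Code.exists_steps_le (P : Code) :
    ∃ p : Polynomial ℕ, ∀ n, P.steps n ≤ p.eval n := by
  induction P with
  | skip => exact ⟨1, fun n => by simp [Code.steps]⟩
  | assign x e =>
    obtain ⟨p, hp⟩ := e.exists_weight_le
    exact ⟨p + 1, fun n => by have := hp n; simp [Code.steps]; omega⟩
  | put a i e =>
    obtain ⟨p, hp⟩ := i.exists_weight_le; obtain ⟨q, hq⟩ := e.exists_weight_le
    exact ⟨p + q + 1, fun n => by have := hp n; have := hq n; simp [Code.steps]; omega⟩
  | seq P Q ihP ihQ =>
    obtain ⟨p, hp⟩ := ihP; obtain ⟨q, hq⟩ := ihQ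
    exact ⟨p + q, fun n => by have := hp n; have := hq n; simp [Code.steps]; omega⟩
  | ite e P Q ihP ihQ =>
    obtain ⟨r, hr⟩ := e.exists_weight_le; obtain ⟨p, hp⟩ := ihP; obtain ⟨q, hq⟩ := ihQ
    exact ⟨r + p + q + 1, fun n => by
      have := hp n; have := hq n; have := hr n; simp [Code.steps]; omega⟩
  | loop x y P ih =>
    obtain ⟨p, hp⟩ := ih
    by_cases hy : y = 0
    · exact ⟨Polynomial.X * (p + 10) + 10, fun n => by
        simp only [Code.steps, hy, if_true, Polynomial.eval_add, Polynomial.eval_mul,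
          Polynomial.eval_X, Polynomial.eval_ofNat]
        gcongr; exact hp n⟩
    · exact ⟨Polynomial.X ^ 4 * (p + 10) + 10, fun n => by
        simp only [Code.steps, hy, if_false, Polynomial.eval_add, Polynomial.eval_mul,
          Polynomial.eval_X, Polynomial.eval_ofNat, Polynomial.eval_pow]
        gcongr; exact hp n⟩

theorem Code.run_reg {x : ℕ} (P : Code) (hP : P.writesReg x = false) (s : Memory) :
    (P.run s).reg x = s.reg x := by
  induction P generalizing s with
  | skip => rfl
  | assign y e => simp only [Code.writesReg, beq_eq_false_iff_ne] at hP
                  simp [Code.run, Memory.setReg, hP]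
  | put a i e => rfl
  | seq P Q ihP ihQ => simp only [Code.writesReg, Bool.or_eq_false_iff] at hP
                       simp only [Code.run]; rw [ihQ hP.2, ihP hP.1]
  | ite e P Q ihP ihQ => simp only [Code.writesReg, Bool.or_eq_false_iff] at hP
                         simp only [Code.run]; split_ifs
                         exacts [ihP hP.1 s, ihQ hP.2 s]
  | loop y z P ih =>
    simp only [Code.writesReg, Bool.or_eq_false_iff, beq_eq_false_iff_ne] at hP
    simp only [Code.run]
    generalize s.reg z = N
    induction N with
    | zero => simp [Memory.setReg, hP.1]
    | succ N ihN =>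
      rw [Function.iterate_succ_apply']
      simp only [Memory.setReg, Function.update_of_ne hP.1] at ihN ⊢
      rw [ih hP.2, ihN]

theorem Code.run_arr {a : ℕ} (P : Code) (hP : P.writesArr a = false) (s : Memory) :
    (P.run s).arr a = s.arr a := by
  induction P generalizing s with
  | skip => rfl
  | assign y e => rfl
  | put b i e => simp only [Code.writesArr, beq_eq_false_iff_ne] at hP
                 simp [Code.run, Memory.setArr, hP]
  | seq P Q ihP ihQ => simp only [Code.writesArr, Bool.or_eq_false_iff] at hP
                       simp only [Code.run]; rw [ihQ hP.2, ihP hP.1]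
  | ite e P Q ihP ihQ => simp only [Code.writesArr, Bool.or_eq_false_iff] at hP
                         simp only [Code.run]; split_ifs
                         exacts [ihP hP.1 s, ihQ hP.2 s]
  | loop y z P ih =>
    simp only [Code.writesArr] at hP
    simp only [Code.run]
    generalize s.reg z = N
    induction N with
    | zero => simp [Memory.setReg]
    | succ N ihN =>
      rw [Function.iterate_succ_apply']
      simp only [Memory.setReg] at ihN ⊢
      rw [ih hP, ihN]

theorem Code.Tame.writesReg {P : Code} (hP : P.Tame) :
    P.writesReg 0 = false ∧ P.writesReg 4 = false := by
  induction P with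
  | skip => simp [Code.writesReg]
  | assign y e => simp only [Code.Tame] at hP; simp [Code.writesReg]; omega
  | put a i e => simp [Code.writesReg]
  | seq P Q ihP ihQ => simp [Code.writesReg, ihP hP.1, ihQ hP.2]
  | ite e P Q ihP ihQ => simp [Code.writesReg, ihP hP.2.1, ihQ hP.2.2]
  | loop x y P ih =>
    simp only [Code.Tame] at hP
    simp [Code.writesReg, ih hP.2.2.2.2]; omega

/-- Invariant rule for counting loops: `I i s` describes the memory `s` before the pass number `i`. -/
theorem Code.run_loop {x y : ℕ} {P : Code} {s : Memory} {N : ℕ} (hN : s.reg y = N)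
    (hP : P.writesReg x = false) (I : ℕ → Memory → Prop) (h0 : I 0 (s.setReg x 0))
    (hI : ∀ i < N, ∀ s, s.reg x = i → I i s → I (i + 1) ((P.run s).setReg x (i + 1))) :
    I N ((Code.loop x y P).run s) := by
  simp only [Code.run, hN]
  suffices h : ∀ i ≤ N, I i ((fun s => (P.run s).setReg x ((P.run s).reg x + 1))^[i] (s.setReg x 0)) ∧
      ((fun s => (P.run s).setReg x ((P.run s).reg x + 1))^[i] (s.setReg x 0)).reg x = i from
    (h N le_rfl).1
  intro i
  induction i with
  | zero => intro _; exact ⟨h0, by simp [Memory.setReg]⟩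
  | succ i ih =>
    intro hi
    obtain ⟨h1, h2⟩ := ih (by omega)
    rw [Function.iterate_succ_apply']
    have h3 := P.run_reg hP ((fun s => (P.run s).setReg x ((P.run s).reg x + 1))^[i] (s.setReg x 0))
    simp only [h3, h2]
    exact ⟨hI i (by omega) _ h2 h1, by simp [Memory.setReg]⟩

/-- A tame program halts in the memory given by `Code.run`, and its logarithmic cost and the bit lengths
of all cells are controlled by `Code.steps`. -/
theorem Code.Tame.exec {n : ℕ} {P : Code} (hP : P.Tame) {s : Memory} {b c : ℕ}
    (h0 : s.reg 0 = n) (h4 : s.reg 4 = n ^ 4) (hs : s.Bounded b) (hc : b + P.steps n ≤ c) :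
    (P.run s).Bounded (b + P.steps n) ∧
      ∃ t, Exec P.compile s (P.run s) t ∧ t ≤ P.steps n * (2 * c + 1) := by
  induction P generalizing s b with
  | skip => exact ⟨hs.mono (by omega), 1, .skip s, by simp only [Code.steps]; omega⟩
  | assign x e =>
    have hv := Expr.eval_lt h0 hs e hP.2.2
    simp only [Code.steps] at hc
    have h1 := Expr.cost_le (c := c) h0 hs e hP.2.2 (by omega)
    have h2 : (e.eval s).size ≤ c :=
      Nat.size_le.2 (hv.trans_le (Nat.pow_le_pow_right two_pos (by omega)))
    refine ⟨(hs.mono (by simp only [Code.steps]; omega)).setReg (hv.trans_le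
      (Nat.pow_le_pow_right two_pos (by simp only [Code.steps]; omega))), _, .assign s x e, ?_⟩
    simp only [Code.steps, add_mul, one_mul]; omega
  | put a i e =>
    have hv := Expr.eval_lt h0 hs e hP.2
    have hi := Expr.eval_lt h0 hs i hP.1
    simp only [Code.steps] at hc
    have h1 := Expr.cost_le (c := c) h0 hs e hP.2 (by omega)
    have h1' := Expr.cost_le (c := c) h0 hs i hP.1 (by omega)
    have h2 : (e.eval s).size ≤ c :=
      Nat.size_le.2 (hv.trans_le (Nat.pow_le_pow_right two_pos (by omega)))
    have h3 : (i.eval s).size ≤ c :=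
      Nat.size_le.2 (hi.trans_le (Nat.pow_le_pow_right two_pos (by omega)))
    refine ⟨(hs.mono (by simp only [Code.steps]; omega)).setArr (hv.trans_le
      (Nat.pow_le_pow_right two_pos (by simp only [Code.steps]; omega))), _, .put s a i e, ?_⟩
    simp only [Code.steps, add_mul, one_mul]; omega
  | seq P Q ihP ihQ =>
    simp only [Code.steps] at hc
    obtain ⟨hb, t, ht, ht'⟩ := ihP hP.1 h0 h4 hs (by omega)
    have hw := hP.1.writesReg
    obtain ⟨hb', t', hu, hu'⟩ := ihQ hP.2 ((P.run_reg hw.1 s).trans h0)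
      ((P.run_reg hw.2 s).trans h4) hb (by omega)
    refine ⟨hb'.mono (by simp only [Code.steps]; omega), _, .seq ht hu, ?_⟩
    simp only [Code.steps, add_mul]; omega
  | ite e P Q ihP ihQ =>
    simp only [Code.steps] at hc
    have h1 := Expr.cost_le (c := c) h0 hs e hP.1 (by omega)
    by_cases he : e.eval s = 0
    · obtain ⟨hb, t, ht, ht'⟩ := ihQ hP.2.2 h0 h4 hs (by omega)
      have hr : (Code.ite e P Q).run s = Q.run s := by simp [Code.run, he]
      rw [hr]
      refine ⟨hb.mono (by simp only [Code.steps]; omega), _, .branch_false he ht, ?_⟩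
      simp only [Code.steps, add_mul, one_mul]
      have : 0 ≤ P.steps n * (2 * c + 1) := Nat.zero_le _
      omega
    · obtain ⟨hb, t, ht, ht'⟩ := ihP hP.2.1 h0 h4 hs (by omega)
      have hr : (Code.ite e P Q).run s = P.run s := by simp [Code.run, he]
      rw [hr]
      refine ⟨hb.mono (by simp only [Code.steps]; omega), _, .branch_true he ht, ?_⟩
      simp only [Code.steps, add_mul, one_mul]
      have : 0 ≤ Q.steps n * (2 * c + 1) := Nat.zero_le _
      omega
  | loop x y P ih =>
    obtain ⟨hx0, hx4, hy, hPx, hPt⟩ := hP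
    have hw := hPt.writesReg
    obtain ⟨N, hN, hNs⟩ : ∃ N, s.reg y = N ∧
        (Code.loop x y P).steps n = N * (P.steps n + 10) + 10 := by
      rcases hy with rfl | rfl
      · exact ⟨n, h0, by simp [Code.steps]⟩
      · exact ⟨n ^ 4, h4, by simp [Code.steps]⟩
    have hyx : y ≠ x := by rcases hy with rfl | rfl <;> omega
    have hPy : P.writesReg y = false := by rcases hy with rfl | rfl <;> simp [hw]
    rw [hNs] at hc ⊢
    set body : Memory → Memory := fun s => (P.run s).setReg x ((P.run s).reg x + 1) with hbody
    have hrun : (Code.loop x y P).run s = body^[N] (s.setReg x 0) := by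
      simp only [Code.run, hN, hbody]
    -- The loop is unfolded from its end: `j` is the number of passes that remain.
    have key : ∀ j ≤ N, ∀ (s : Memory) (b : ℕ), s.reg 0 = n → s.reg 4 = n ^ 4 → s.reg y = N →
        s.reg x = N - j → s.Bounded b → b + (j * (P.steps n + 10) + 4) ≤ c →
        (body^[j] s).Bounded (b + j * (P.steps n + 10)) ∧
        ∃ t, Exec (.loop (.sub (.reg y) (.reg x))
          (.seq P.compile (.assign x (.add (.reg x) (.lit 1))))) s (body^[j] s) t ∧
          t ≤ (j * (P.steps n + 10) + 4) * (2 * c + 1) := by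
      intro j
      induction j with
      | zero =>
        intro _ s b h0 h4 hy hx hb hc
        refine ⟨by simpa using hb, _, .loop_false (by simp [Expr.eval, hy, hx]), ?_⟩
        have := Expr.cost_le (c := c) h0 hb (.sub (.reg y) (.reg x)) ⟨trivial, trivial⟩
          (by simp only [Expr.weight]; omega)
        simp only [Expr.weight] at this
        simp only [add_mul]; omega
      | succ j ihj =>
        intro hj s b h0 h4 hy hx hb hc
        have hexp : (j + 1) * (P.steps n + 10) = j * (P.steps n + 10) + P.steps n + 10 := by ring
        rw [hexp] at hc ⊢
        obtain ⟨hb1, t1, ht1, ht1'⟩ := ih hPt h0 h4 hb (by omega)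
        have r0 : (P.run s).reg 0 = n := (P.run_reg hw.1 s).trans h0
        have r4 : (P.run s).reg 4 = n ^ 4 := (P.run_reg hw.2 s).trans h4
        have ry : (P.run s).reg y = N := (P.run_reg hPy s).trans hy
        have rx : (P.run s).reg x = N - (j + 1) := (P.run_reg hPx s).trans hx
        have hlin : (Expr.add (.reg x) (.lit 1)).Linear := ⟨trivial, trivial⟩
        have hwt : (Expr.add (.reg x) (.lit 1)).weight n = 4 := by simp [Expr.weight]
        have hv := Expr.eval_lt r0 hb1 _ hlin
        rw [hwt] at hv
        have hb2 : (body s).Bounded (b + P.steps n + 10) := by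
          refine (hb1.mono (by omega)).setReg (hv.trans_le (Nat.pow_le_pow_right two_pos (by omega)))
        obtain ⟨hb3, t3, ht3, ht3'⟩ := ihj (by omega) (body s) (b + P.steps n + 10)
          (by simp only [hbody, Memory.setReg, Function.update_of_ne hx0.symm, r0])
          (by simp only [hbody, Memory.setReg, Function.update_of_ne hx4.symm, r4])
          (by simp only [hbody, Memory.setReg, Function.update_of_ne hyx, ry])
          (by simp only [hbody, Memory.setReg, Function.update_self, rx]; omega) hb2 (by omega)
        rw [Function.iterate_succ_apply]
        have htest : (Expr.sub (.reg y) (.reg x)).eval s ≠ 0 := by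
          simp only [Expr.eval, hy, hx]; omega
        refine ⟨hb3.mono (by omega), _,
          .loop_true htest (.seq ht1 (.assign (P.run s) x (.add (.reg x) (.lit 1)))) ht3, ?_⟩
        have c1 := Expr.cost_le (c := c) h0 hb (.sub (.reg y) (.reg x)) ⟨trivial, trivial⟩
          (by simp only [Expr.weight]; omega)
        have c2 := Expr.cost_le (c := c) r0 hb1 _ hlin (by rw [hwt]; omega)
        have c3 : ((Expr.add (.reg x) (.lit 1)).eval (P.run s)).size ≤ c :=
          Nat.size_le.2 (hv.trans_le (Nat.pow_le_pow_right two_pos (by omega)))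
        rw [hwt] at c2
        simp only [Expr.weight] at c1
        simp only [add_mul] at ht3' ht1' c1 c2 ⊢
        omega
    have hset : (s.setReg x 0).Bounded b := hs.setReg (by positivity)
    obtain ⟨k1, t, k2, k3⟩ := key N le_rfl (s.setReg x 0) b
      (by simp only [Memory.setReg, Function.update_of_ne hx0.symm, h0])
      (by simp only [Memory.setReg, Function.update_of_ne hx4.symm, h4])
      (by simp only [Memory.setReg, Function.update_of_ne hyx, hN])
      (by simp only [Memory.setReg, Function.update_self]; omega) hset (by omega)
    rw [hrun]
    refine ⟨k1.mono (by omega), _, .seq (.assign s x (.lit 0)) k2, ?_⟩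
    simp only [Expr.cost, Expr.eval, Nat.size_zero]
    simp only [add_mul] at k3 ⊢
    omega

/-- Every write to an array satisfies `Q`. -/
def Code.AllPuts (Q : ℕ → Expr → Expr → Prop) : Code → Prop
  | .skip => True
  | .assign _ _ => True
  | .put a i e => Q a i e
  | .seq P R => P.AllPuts Q ∧ R.AllPuts Q
  | .ite _ P R => P.AllPuts Q ∧ R.AllPuts Q
  | .loop _ _ P => P.AllPuts Q

/-- A property of the array entries is an invariant of a program if all written values have it. -/
theorem Code.AllPuts.run {J : ℕ → Prop} {P : Code}
    (hP : P.AllPuts fun _ _ e => ∀ s : Memory, (∀ a i, J (s.arr a i)) → J (e.eval s))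
    {s : Memory} (hs : ∀ a i, J (s.arr a i)) : ∀ a i, J ((P.run s).arr a i) := by
  induction P generalizing s with
  | skip => exact hs
  | assign x e => exact hs
  | put a i e =>
    intro a' j
    have := hP s hs
    by_cases ha : a' = a
    · subst ha
      by_cases hj : j = i.eval s
      · subst hj; simpa [Code.run, Memory.setArr] using this
      · simpa [Code.run, Memory.setArr, hj] using hs a' j
    · simpa [Code.run, Memory.setArr, ha] using hs a' j
  | seq P Q ihP ihQ => exact ihQ hP.2 (ihP hP.1 hs)
  | ite e P Q ihP ihQ =>
    simp only [Code.run]; split_ifs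
    exacts [ihP hP.1 hs, ihQ hP.2 hs]
  | loop x y P ih =>
    simp only [Code.run]
    generalize s.reg y = N
    induction N with
    | zero => exact hs
    | succ N ihN =>
      rw [Function.iterate_succ_apply']
      exact ih hP ihN

/-! ### Halfspaces and their borders -/

section Combinatorics

variable {V : Type*} {G : SimpleGraph V}

/-- The vertices of `H` with a neighbour outside `H` are pairwise adjacent. -/
def BorderClique (G : SimpleGraph V) (H : Set V) : Prop :=
  ∀ ⦃u v u' v'⦄, u ∈ H → v ∉ H → u' ∈ H → v' ∉ H → G.Adj u v → G.Adj u' v' → u ≠ u' → G.Adj u u'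

/-- Both borders of the cut between `H` and its complement are cliques. In a connected graph these are
exactly the m-halfspaces. -/
def CliqueCut (G : SimpleGraph V) (H : Set V) : Prop := BorderClique G H ∧ BorderClique G Hᶜ

theorem CliqueCut.compl {H : Set V} (h : CliqueCut G H) : CliqueCut G Hᶜ :=
  ⟨h.2, by rw [compl_compl]; exact h.1⟩

/-- Among the walks inside `S` that join two given vertices, a shortest one is an induced path. -/
theorem exists_chordless_path {S : Set V} {u v : V} (p : G.Walk u v) (hp : ∀ x ∈ p.support, x ∈ S) :
    ∃ q : G.Walk u v, q.IsPath ∧ q.IsChordless ∧ ∀ x ∈ q.support, x ∈ S := by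
  classical
  induction hl : p.length using Nat.strong_induction_on generalizing p with
  | _ l ih =>
    by_cases hpath : p.IsPath
    · by_cases hch : p.IsChordless
      · exact ⟨p, hpath, hch, hp⟩
      rw [SimpleGraph.Walk.isChordless_iff_forall_mem_edges] at hch
      push Not at hch
      obtain ⟨x, y, hx, hy, hxy, he⟩ := hch
      rw [SimpleGraph.Walk.mem_support_iff_exists_getVert] at hx hy
      obtain ⟨i, rfl, hi⟩ := hx
      obtain ⟨j, rfl, hj⟩ := hy
      -- A chord joining the positions `i < j` shortens the walk.
      have short : ∀ i j, i < j → j ≤ p.length → G.Adj (p.getVert i) (p.getVert j) →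
          s(p.getVert i, p.getVert j) ∉ p.edges →
          ∃ q : G.Walk u v, q.IsPath ∧ q.IsChordless ∧ ∀ x ∈ q.support, x ∈ S := by
        intro i j hij hj hadj he
        have hj1 : j ≠ i + 1 := by
          rintro rfl
          apply he
          rw [SimpleGraph.Walk.mk_mem_edges_iff_exists]
          exact ⟨i, by omega, by simp⟩
        refine ih ((p.take i).append (.cons hadj (p.drop j))).length ?_ _ ?_ rfl
        · simp only [SimpleGraph.Walk.length_append, SimpleGraph.Walk.length_cons,
            SimpleGraph.Walk.take_length, SimpleGraph.Walk.drop_length]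
          omega
        · intro x hx
          rw [SimpleGraph.Walk.mem_support_append_iff, SimpleGraph.Walk.support_cons,
            List.mem_cons] at hx
          rcases hx with hx | rfl | hx
          · exact hp _ (by rw [SimpleGraph.Walk.support_take] at hx; exact List.mem_of_mem_take hx)
          · exact hp _ (p.getVert_mem_support _)
          · exact hp _ (by
              rw [SimpleGraph.Walk.drop_support_eq_support_drop_min] at hx; exact List.mem_of_mem_drop hx)
      rcases lt_trichotomy i j with h | h | h
      · exact short i j h hj hxy he
      · exact absurd (h ▸ hxy) (G.loopless.irrefl _)
      · exact short j i h hi hxy.symm (by rwa [Sym2.eq_swap])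
    · refine ih p.bypass.length ?_ p.bypass
        (fun x hx => hp x (p.support_bypass_subset_support hx)) rfl
      rw [← hl]
      refine lt_of_le_of_ne p.length_bypass_le_length fun h => hpath ?_
      rw [← SimpleGraph.Walk.bypass_eq_self_of_length_le_length_bypass p h.ge]
      exact p.bypass_isPath

/-- In a connected graph, an m-convex set whose complement is m-convex has a clique as its border. -/
theorem IsMConvex.borderClique (hG : G.Connected) {H : Set V} (h : IsMConvex G H)
    (h' : IsMConvex G Hᶜ) : BorderClique G H := by
  intro u v u' v' hu hv hu' hv' huv hu'v' hne
  by_contra hadj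
  obtain ⟨w⟩ := hG.preconnected v v'
  obtain ⟨q, hq, hqc, -⟩ := exists_chordless_path (S := Set.univ) w (by simp)
  -- `v` and `v'` are joined outside `H`, hence `u` and `u'` are joined by an induced path whose inner
  -- vertices are outside `H`.
  have hqH : ∀ x ∈ q.support, x ∈ Hᶜ := fun x hx => h' v hv v' hv' ⟨q, hq, hqc, hx⟩
  obtain ⟨r, hr, hrc, hrs⟩ := exists_chordless_path (S := {x | x = u ∨ x = u' ∨ x ∉ H})
    (.cons huv (q.append (.cons hu'v'.symm .nil))) (by
      intro x hx
      simp only [SimpleGraph.Walk.support_cons, List.mem_cons,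
        SimpleGraph.Walk.mem_support_append_iff, SimpleGraph.Walk.support_nil,
        List.not_mem_nil, or_false] at hx
      rcases hx with rfl | hx | rfl | rfl
      · exact .inl rfl
      · exact .inr (.inr (hqH x hx))
      · exact .inr (.inr hv')
      · exact .inr (.inl rfl))
  cases r with
  | nil => exact hne rfl
  | cons hux r =>
    rename_i x
    have hxs : x ∈ (SimpleGraph.Walk.cons hux r).support := by simp
    rcases hrs x hxs with rfl | rfl | hx
    · exact G.loopless.irrefl _ hux
    · exact hadj hux
    · exact hx (h u hu u' hu' ⟨_, hr, hrc, hxs⟩)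

theorem BorderClique.isMConvex {H : Set V} (h : BorderClique G H) : IsMConvex G H := by
  rintro u hu w hw x ⟨p, hp, hc, hx⟩
  by_contra hxH
  rw [SimpleGraph.Walk.mem_support_iff_exists_getVert] at hx
  obtain ⟨k, rfl, hk⟩ := hx
  classical
  -- The path leaves `H` at position `i` and comes back at position `j + 1 > i + 1`.
  obtain ⟨i, hik, hi, hi'⟩ : ∃ i < k, p.getVert i ∈ H ∧ p.getVert (i + 1) ∉ H := by
    by_contra! hcon
    have : ∀ m ≤ k, p.getVert m ∈ H := by
      intro m
      induction m with
      | zero => intro _; simpa using hu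
      | succ m ih => exact fun hm => hcon m (by omega) (ih (by omega))
    exact hxH (this k le_rfl)
  obtain ⟨j, hkj, hj, hjH, hj'⟩ :
      ∃ j, k ≤ j ∧ j < p.length ∧ p.getVert j ∉ H ∧ p.getVert (j + 1) ∈ H := by
    by_contra! hcon
    have : ∀ m, k + m ≤ p.length → p.getVert (k + m) ∉ H := by
      intro m
      induction m with
      | zero => intro _; simpa using hxH
      | succ m ih => exact fun hm => hcon (k + m) (by omega) (by omega) (ih (by omega))
    have := this (p.length - k) (by omega)
    rw [show k + (p.length - k) = p.length by omega, SimpleGraph.Walk.getVert_length] at this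
    exact this hw
  have inj := hp.getVert_injOn
  have hne : p.getVert i ≠ p.getVert (j + 1) := fun he => by
    have := inj (by simp; omega) (by simp; omega) he
    omega
  have hadj := h hi hi' hj' hjH (p.adj_getVert_succ (by omega)) (p.adj_getVert_succ hj).symm hne
  have hedge := hc.mem_edges (p.getVert_mem_support _) (p.getVert_mem_support _) hadj
  rw [SimpleGraph.Walk.mk_mem_edges_iff_exists] at hedge
  obtain ⟨m, hm, he⟩ := hedge
  rw [Sym2.eq_iff] at he
  rcases he with ⟨e1, e2⟩ | ⟨e1, e2⟩
  · have := inj (by simp; omega) (by simp; omega) e1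
    have := inj (by simp; omega) (by simp; omega) e2
    omega
  · have := inj (by simp; omega) (by simp; omega) e1
    have := inj (by simp; omega) (by simp; omega) e2
    omega

theorem mem_mHalfspaces_iff [Fintype V] (hG : G.Connected) {H : Finset V} :
    H ∈ mHalfspaces G ↔ CliqueCut G (H : Set V) := by
  simp only [mHalfspaces, Finset.mem_filter, Finset.mem_univ, true_and]
  refine ⟨fun h => ⟨h.1.borderClique hG h.2, h.2.borderClique hG (by rw [compl_compl]; exact h.1)⟩,
    fun h => ⟨h.1.isMConvex, h.2.isMConvex⟩⟩

end Combinatorics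

/-! ### Propagation of labels -/

section Propagation

variable {V : Type*} {G : SimpleGraph V} {H K : Set V} {a b : V}

/-- One half of `PropClosed`: the inferences for a vertex `u ∈ H`. If `u v` and `u' v'` are edges with
`u ≠ u'` not adjacent, then `u, u' ∈ H` and `v, v' ∉ H` is impossible. The condition on `v` may also be
replaced by `v = v'`, or by `v` being adjacent to `v'` and not to `u'`, because then one of the
edges `u v` and `v v'` can serve as the first edge. -/
def HalfClosed (G : SimpleGraph V) (H K : Set V) : Prop :=
  ∀ ⦃u v u' v'⦄, G.Adj u v → G.Adj u' v' → u ≠ u' → ¬ G.Adj u u' → u ∈ K → u ∈ H →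
    (v ∈ K ∧ v ∉ H ∨ v = v' ∨ G.Adj v v' ∧ ¬ G.Adj v u') →
    (u' ∈ K → u' ∈ H → v' ∈ K) ∧ (v' ∈ K → v' ∉ H → u' ∈ K)

/-- If the labels with respect to `H` of the vertices in `K` are known, then no further label can be
inferred by a single step of propagation. -/
def PropClosed (G : SimpleGraph V) (H K : Set V) : Prop :=
  HalfClosed G H K ∧ HalfClosed G Hᶜ K

theorem PropClosed.compl (h : PropClosed G H K) : PropClosed G Hᶜ K :=
  ⟨h.2, by rw [compl_compl]; exact h.1⟩

/-- The pattern excluded by propagation does not occur. -/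
theorem BorderClique.not_pattern (h : BorderClique G H) {u v u' v' : V} (huv : G.Adj u v)
    (hu'v' : G.Adj u' v') (hne : u ≠ u') (hna : ¬ G.Adj u u') (hu : u ∈ H) (hu' : u' ∈ H)
    (hv' : v' ∉ H) (hv : v ∉ H ∨ v = v' ∨ G.Adj v v' ∧ ¬ G.Adj v u') : False := by
  by_cases hvH : v ∈ H
  · rcases hv with hv | rfl | ⟨h1, h2⟩
    · exact hv hvH
    · exact hv' hvH
    · exact h2 (h hvH hv' hu' hv' h1 hu'v' (by rintro rfl; exact hna huv))
  · exact hna (h hu hvH hu' hv' huv hu'v' hne)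

/-- The neighbours of `a` outside the closed neighbourhood of `b`. -/
def Wing (G : SimpleGraph V) (a b x : V) : Prop := G.Adj a x ∧ ¬ G.Adj b x ∧ x ≠ b

/-- The common neighbours of `a` and `b`. -/
def Mid (G : SimpleGraph V) (a b c : V) : Prop := G.Adj a c ∧ G.Adj b c

/-- The vertices outside the closed neighbourhoods of `a` and `b`. -/
def Far (G : SimpleGraph V) (a b z : V) : Prop := z ≠ a ∧ z ≠ b ∧ ¬ G.Adj a z ∧ ¬ G.Adj b z

/-- Two vertices are tied if, in every halfspace that contains `a` and not `b`, the label of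
one determines the label of the other for one of two reasons: an edge at a far vertex is never cut, and
two common neighbours of `a` and `b` that are not adjacent are always separated. -/
def Tied (G : SimpleGraph V) (a b w w' : V) : Prop :=
  G.Adj w w' ∧ (Far G a b w ∨ Far G a b w') ∨
    Mid G a b w ∧ Mid G a b w' ∧ w ≠ w' ∧ ¬ G.Adj w w'

theorem Mid.symm {c : V} (h : Mid G a b c) : Mid G b a c := ⟨h.2, h.1⟩

theorem Far.symm {c : V} (h : Far G a b c) : Far G b a c := ⟨h.2.1, h.1, h.2.2.2, h.2.2.1⟩

theorem Tied.symm {w w' : V} (h : Tied G a b w w') : Tied G a b w' w := by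
  rcases h with ⟨h1, h2⟩ | ⟨h1, h2, h3, h4⟩
  · exact .inl ⟨h1.symm, h2.symm⟩
  · exact .inr ⟨h2, h1, h3.symm, fun h => h4 h.symm⟩

theorem Tied.swap {w w' : V} (h : Tied G a b w w') : Tied G b a w w' := by
  rcases h with ⟨h1, h2⟩ | ⟨h1, h2, h3, h4⟩
  · exact .inl ⟨h1, h2.imp Far.symm Far.symm⟩
  · exact .inr ⟨h1.symm, h2.symm, h3, h4⟩

/-- A set of vertices that encodes the neighbours of `c` in the two wings: the neighbours in the wing of
`a` and the non-neighbours in the wing of `b`. Among the common neighbours of `a` and `b`,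
membership in `H` is monotone with respect to this set. -/
def profile (G : SimpleGraph V) (a b c : V) : Set V :=
  {x | Wing G a b x ∧ G.Adj x c ∨ Wing G b a x ∧ ¬ G.Adj x c}

theorem Wing.disjoint {x : V} (h : Wing G a b x) (h' : Wing G b a x) : False := h'.2.1 h.1

/-- A cut edge `a b`, with `a` inside and `b` outside. -/
structure CutEdge (G : SimpleGraph V) (H : Set V) (a b : V) : Prop where
  cut : CliqueCut G H
  adj : G.Adj a b
  left : a ∈ H
  right : b ∉ H

theorem CutEdge.swap (h : CutEdge G H a b) : CutEdge G Hᶜ b a :=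
  ⟨h.cut.compl, h.adj.symm, h.right, fun h' => h' h.left⟩

theorem CutEdge.wing_mem (h : CutEdge G H a b) {x : V} (hx : Wing G a b x) : x ∈ H := by
  by_contra hxH
  exact hx.2.1 (h.cut.2 h.right (fun h' => h' h.left) hxH (fun h' => h' h.left) h.adj.symm
    hx.1.symm hx.2.2.symm)

theorem CutEdge.wing_notMem (h : CutEdge G H a b) {x : V} (hx : Wing G b a x) : x ∉ H :=
  h.swap.wing_mem hx

theorem CutEdge.wing_known (h : CutEdge G H a b) (hK : PropClosed G H K) (ha : a ∈ K) (hb : b ∈ K)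
    {x : V} (hx : Wing G a b x) : x ∈ K :=
  (hK.2 h.adj.symm hx.1.symm hx.2.2.symm hx.2.1 hb h.right
    (.inl ⟨ha, fun h' => h' h.left⟩)).2 ha fun h' => h' h.left

/-- An edge at a far vertex is not cut. -/
theorem CutEdge.far_mem_iff (h : CutEdge G H a b) {z w : V} (hz : Far G a b z) (hzw : G.Adj z w) :
    z ∈ H ↔ w ∈ H := by
  constructor
  · intro hzH
    by_contra hw
    exact hz.2.2.1 (h.cut.1 h.left h.right hzH hw h.adj hzw hz.1.symm)
  · intro hw
    by_contra hzH
    exact hz.2.2.2 (h.cut.2 h.right (fun h' => h' h.left) hzH (fun h' => h' hw) h.adj.symm hzw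
      hz.2.1.symm)

/-- Of two common neighbours of `a` and `b` that are not adjacent, at most one is in `H`. -/
theorem CutEdge.mid_notMem (h : CutEdge G H a b) {c c' : V} (hc : Mid G a b c) (hc' : Mid G a b c')
    (hne : c ≠ c') (hna : ¬ G.Adj c c') (hcH : c ∈ H) : c' ∉ H := fun hc'H =>
  hna (h.cut.1 hcH h.right hc'H h.right hc.2.symm hc'.2.symm hne)

theorem CutEdge.mid_mem_iff (h : CutEdge G H a b) {c c' : V} (hc : Mid G a b c) (hc' : Mid G a b c')
    (hne : c ≠ c') (hna : ¬ G.Adj c c') : c ∈ H ↔ c' ∉ H :=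
  ⟨h.mid_notMem hc hc' hne hna, fun h' => by
    by_contra h''
    exact h.swap.mid_notMem hc.symm hc'.symm hne hna h'' h'⟩

theorem CutEdge.known_of_tied_of_mem (h : CutEdge G H a b) (hK : PropClosed G H K) (ha : a ∈ K)
    (hb : b ∈ K) {w w' : V} (ht : Tied G a b w w') (hw : w ∈ K) (hwH : w ∈ H) : w' ∈ K := by
  rcases ht with ⟨hadj, hz | hz⟩ | ⟨h1, h2, h3, h4⟩
  · exact (hK.1 h.adj hadj hz.1.symm hz.2.2.1 ha h.left (.inl ⟨hb, h.right⟩)).1 hw hwH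
  · exact (hK.2 h.adj.symm hadj.symm hz.2.1.symm hz.2.2.2 hb h.right
      (.inl ⟨ha, fun h' => h' h.left⟩)).2 hw fun h' => h' hwH
  · exact (hK.1 h1.2.symm h2.2.symm h3 h4 hw hwH (.inr (.inl rfl))).2 hb h.right

theorem CutEdge.known_of_tied (h : CutEdge G H a b) (hK : PropClosed G H K) (ha : a ∈ K)
    (hb : b ∈ K) {w w' : V} (ht : Tied G a b w w') (hw : w ∈ K) : w' ∈ K := by
  by_cases hwH : w ∈ H
  · exact h.known_of_tied_of_mem hK ha hb ht hw hwH
  · exact h.swap.known_of_tied_of_mem hK.compl hb ha ht.swap hw hwH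

theorem CutEdge.profile_subset (h : CutEdge G H a b) {c c' : V} (hc : Mid G a b c)
    (hc' : Mid G a b c') (hcH : c ∈ H) (hc'H : c' ∉ H) : profile G a b c' ⊆ profile G a b c := by
  rintro x (⟨hx, hxc⟩ | ⟨hx, hxc⟩)
  · refine .inl ⟨hx, h.cut.1 (h.wing_mem hx) hc'H hcH h.right hxc hc.2.symm ?_⟩
    rintro rfl; exact hx.2.1 hc.2
  · refine .inr ⟨hx, fun hxc' => hxc ?_⟩
    refine h.cut.2 (h.wing_notMem hx) (fun h' => h' hcH) hc'H (fun h' => h' h.left) hxc' hc'.1.symm ?_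
    rintro rfl; exact hx.2.1 hc'.1

/-- A known common neighbour in `H` bounds the profiles of the unknown common neighbours from above. -/
theorem CutEdge.profile_subset_of_known (h : CutEdge G H a b) (hK : PropClosed G H K) (ha : a ∈ K)
    (hb : b ∈ K) {c c₁ : V} (hc : Mid G a b c) (hcK : c ∉ K) (hc₁ : Mid G a b c₁) (hc₁K : c₁ ∈ K)
    (hc₁H : c₁ ∈ H) : profile G a b c ⊆ profile G a b c₁ := by
  rintro x (⟨hx, hxc⟩ | ⟨hx, hxc⟩)
  · refine .inl ⟨hx, ?_⟩
    by_contra hxc₁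
    refine hcK ((hK.1 hc₁.2.symm hxc ?_ (fun h' => hxc₁ h'.symm) hc₁K hc₁H
      (.inl ⟨hb, h.right⟩)).1 (h.wing_known hK ha hb hx) (h.wing_mem hx))
    rintro rfl; exact hx.2.1 hc₁.2
  · refine .inr ⟨hx, fun hxc₁ => hcK ?_⟩
    refine (hK.2 hxc₁ hc.1.symm ?_ hxc (h.swap.wing_known hK.compl hb ha hx) (h.wing_notMem hx)
      (.inl ⟨hc₁K, fun h' => h' hc₁H⟩)).2 ha fun h' => h' h.left
    rintro rfl; exact hx.2.1 hc.1

theorem profile_swap_subset_iff {c c' : V} :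
    profile G b a c ⊆ profile G b a c' ↔ profile G a b c' ⊆ profile G a b c := by
  have key : ∀ (a b c c' : V), profile G b a c ⊆ profile G b a c' →
      profile G a b c' ⊆ profile G a b c := by
    rintro a b c c' hs x (⟨hx, hxc⟩ | ⟨hx, hxc⟩)
    · refine .inl ⟨hx, ?_⟩
      by_contra hxc'
      rcases hs (.inr ⟨hx, hxc'⟩) with h | h
      · exact hx.disjoint h.1
      · exact h.2 hxc
    · refine .inr ⟨hx, fun hxc' => ?_⟩
      rcases hs (.inl ⟨hx, hxc'⟩) with h | h
      · exact hxc h.2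
      · exact hx.disjoint h.1
  exact ⟨key a b c c', key b a c' c⟩

/-- Two vertices labelled in advance, one on each side, suffice to make the profiles of the unknown
common neighbours constant on each side of the halfspace. -/
theorem CutEdge.exists_guess [Finite V] (h : CutEdge G H a b) :
    ∃ c₁ ∈ H, ∃ c₂ ∉ H, ∀ K, PropClosed G H K → a ∈ K → b ∈ K → c₁ ∈ K → c₂ ∈ K →
      ∀ c c', Mid G a b c → Mid G a b c' → c ∉ K → c' ∉ K → (c ∈ H ↔ c' ∈ H) →
        profile G a b c = profile G a b c' := by
  -- It suffices to fix the profile on one side.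
  have side : ∀ (H : Set V) (a b : V), CutEdge G H a b → ∃ c₁ ∈ H, ∀ K, PropClosed G H K →
      a ∈ K → b ∈ K → c₁ ∈ K → ∀ c, Mid G a b c → c ∉ K → c ∈ H →
        profile G a b c = profile G a b c₁ := by
    intro H a b h
    by_cases hne : {c | Mid G a b c ∧ c ∈ H}.Nonempty
    · obtain ⟨c₁, ⟨hc₁, hc₁H⟩, hmin⟩ := Set.exists_min_image _
        (fun c => (profile G a b c).ncard) (Set.toFinite {c | Mid G a b c ∧ c ∈ H}) hne
      refine ⟨c₁, hc₁H, fun K hK ha hb hc₁K c hc hcK hcH => ?_⟩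
      exact Set.eq_of_subset_of_ncard_le
        (h.profile_subset_of_known hK ha hb hc hcK hc₁ hc₁K hc₁H) (hmin c ⟨hc, hcH⟩)
        (Set.toFinite _)
    · exact ⟨a, h.left, fun K hK ha hb hc₁K c hc hcK hcH => absurd ⟨c, hc, hcH⟩ hne⟩
  obtain ⟨c₁, hc₁, h₁⟩ := side H a b h
  obtain ⟨c₂, hc₂, h₂⟩ := side Hᶜ b a h.swap
  refine ⟨c₁, hc₁, c₂, hc₂, fun K hK ha hb hK₁ hK₂ c c' hc hc' hcK hc'K hiff => ?_⟩
  by_cases hcH : c ∈ H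
  · exact (h₁ K hK ha hb hK₁ c hc hcK hcH).trans
      (h₁ K hK ha hb hK₁ c' hc' hc'K (hiff.1 hcH)).symm
  · have e := (h₂ K hK.compl hb ha hK₂ c hc.symm hcK hcH).trans
      (h₂ K hK.compl hb ha hK₂ c' hc'.symm hc'K fun h' => hcH (hiff.2 h')).symm
    exact (profile_swap_subset_iff.1 e.ge).antisymm (profile_swap_subset_iff.1 e.le)

/-- Unknown common neighbours that are tied to each other have the same profile. -/
theorem CutEdge.profile_eq_of_tied (h : CutEdge G H a b) (hK : PropClosed G H K) (ha : a ∈ K)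
    (hb : b ∈ K) {c c' : V} (hc : Mid G a b c) (hc' : Mid G a b c') (hcK : c ∉ K) (hc'K : c' ∉ K)
    (hna : ¬ G.Adj c c') (hcH : c ∈ H) (hc'H : c' ∉ H) :
    profile G a b c = profile G a b c' := by
  refine Set.Subset.antisymm ?_ (h.profile_subset hc hc' hcH hc'H)
  rintro x (⟨hx, hxc⟩ | ⟨hx, hxc⟩)
  · refine .inl ⟨hx, ?_⟩
    by_contra hxc'
    refine hc'K ((hK.1 hxc hc'.2.symm ?_ hxc' (h.wing_known hK ha hb hx) (h.wing_mem hx)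
      (.inr (.inr ⟨hc.2.symm, hna⟩))).2 hb h.right)
    rintro rfl; exact hx.2.1 hc'.2
  · refine .inr ⟨hx, fun hxc' => hcK ?_⟩
    refine (hK.2 hxc' hc.1.symm ?_ hxc (h.swap.wing_known hK.compl hb ha hx) (h.wing_notMem hx)
      (.inr (.inr ⟨hc'.1.symm, fun h' => hna h'.symm⟩))).2 ha fun h' => h' h.left
    rintro rfl; exact hx.2.1 hc.1

/-- The conditions under which the labels of all vertices in `F` can be reversed. -/
structure Flippable (G : SimpleGraph V) (H K : Set V) (a b : V) (F : Set V) : Prop where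
  closed : PropClosed G H K
  left : a ∈ K
  right : b ∈ K
  unknown : ∀ w ∈ F, w ∉ K
  tied : ∀ w w', Tied G a b w w' → w ∈ F → w' ∈ F
  profile_eq : ∀ c c', Mid G a b c → Mid G a b c' → c ∉ K → c' ∉ K → (c ∈ H ↔ c' ∈ H) →
    profile G a b c = profile G a b c'
  profile_eq' : ∀ c c', Mid G a b c → Mid G a b c' → c ∈ F → c' ∈ F →
    profile G a b c = profile G a b c'

theorem profile_swap_eq_iff {c c' : V} :
    profile G b a c = profile G b a c' ↔ profile G a b c = profile G a b c' := by
  simp only [Set.Subset.antisymm_iff, profile_swap_subset_iff (a := a) (b := b), and_comm]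

theorem Flippable.swap {F : Set V} (h : Flippable G H K a b F) : Flippable G Hᶜ K b a F where
  closed := h.closed.compl
  left := h.right
  right := h.left
  unknown := h.unknown
  tied w w' ht := h.tied w w' ht.swap
  profile_eq c c' hc hc' hK hK' hiff := profile_swap_eq_iff.2
    (h.profile_eq c c' hc.symm hc'.symm hK hK' (not_iff_not.1 hiff))
  profile_eq' c c' hc hc' hF hF' := profile_swap_eq_iff.2
    (h.profile_eq' c c' hc.symm hc'.symm hF hF')

theorem Flippable.borderClique (h : CutEdge G H a b) {F : Set V} (hF : Flippable G H K a b F) :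
    BorderClique G (symmDiff H F) := by
  have hK := hF.closed
  have mem : ∀ w, w ∈ symmDiff H F ↔ (w ∈ H ↔ w ∉ F) := fun w => by
    rw [Set.mem_symmDiff]; tauto
  have known : ∀ w ∈ K, w ∉ F := fun w hw hwF => hF.unknown w hwF hw
  have memK : ∀ w ∈ K, (w ∈ symmDiff H F ↔ w ∈ H) := fun w hw => by
    rw [mem]; have := known w hw; tauto
  have far : ∀ z w, Far G a b z → G.Adj z w → (z ∈ symmDiff H F ↔ w ∈ symmDiff H F) := by
    intro z w hz hzw
    rw [mem, mem, h.far_mem_iff hz hzw]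
    have h1 := hF.tied z w (.inl ⟨hzw, .inl hz⟩)
    have h2 := hF.tied w z (.inl ⟨hzw.symm, .inr hz⟩)
    tauto
  -- The endpoints of a cut edge are in the closed neighbourhoods of `a` and of `b`.
  have left : ∀ u v, G.Adj u v → u ∈ symmDiff H F → v ∉ symmDiff H F → u ≠ a → G.Adj a u := by
    intro u v huv hu hv hua
    by_contra hau
    by_cases hub : u = b
    · subst hub; exact h.right ((memK _ hF.right).1 hu)
    by_cases hbu : G.Adj b u
    · have hw : Wing G b a u := ⟨hbu, hau, hua⟩
      exact h.wing_notMem hw ((memK _ (h.swap.wing_known hK.compl hF.right hF.left hw)).1 hu)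
    · exact hv ((far u v ⟨hua, hub, hau, hbu⟩ huv).1 hu)
  have right : ∀ u v, G.Adj u v → u ∈ symmDiff H F → v ∉ symmDiff H F → v ≠ b → G.Adj b v := by
    intro u v huv hu hv hvb
    by_contra hbv
    by_cases hva : v = a
    · subst hva; exact hv ((memK _ hF.left).2 h.left)
    by_cases hav : G.Adj a v
    · have hw : Wing G a b v := ⟨hav, hbv, hvb⟩
      exact hv ((memK _ (h.wing_known hK hF.left hF.right hw)).2 (h.wing_mem hw))
    · exact hv ((far v u ⟨hva, hvb, hav, hbv⟩ huv.symm).2 hu)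
  have knownMem : ∀ w ∈ symmDiff H F, w ∈ K → w ∈ H := fun w hw hwK => (memK w hwK).1 hw
  have knownNotMem : ∀ w ∉ symmDiff H F, w ∈ K → w ∉ H := fun w hw hwK h' => hw ((memK w hwK).2 h')
  -- A neighbour, outside the flipped set, of a vertex in the wing of `a` is known or common.
  have outer : ∀ u v, G.Adj u v → u ∈ symmDiff H F → v ∉ symmDiff H F → Wing G a b u →
      v ∈ K ∨ Mid G a b v := by
    intro u v huv hu hv hw
    have hvb : v ≠ b := by rintro rfl; exact hw.2.1 huv.symm
    have hbv := right u v huv hu hv hvb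
    by_cases hav : G.Adj a v
    · exact .inr ⟨hav, hbv⟩
    · by_cases hva : v = a
      · exact .inl (hva ▸ hF.left)
      · exact .inl (h.swap.wing_known hK.compl hF.right hF.left ⟨hbv, hav, hva⟩)
  -- A border vertex in the wing of `a` is adjacent to a border vertex in the middle.
  have wingMid : ∀ u v u', G.Adj u v → u ∈ symmDiff H F → v ∉ symmDiff H F → Wing G a b u →
      u' ∈ symmDiff H F → Mid G a b u' → G.Adj u u' := by
    intro u v u' huv hu hv hw hu' hm'
    by_contra hna
    have hne : u ≠ u' := by rintro rfl; exact hw.2.1 hm'.2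
    have huK := h.wing_known hK hF.left hF.right hw
    have huH := h.wing_mem hw
    have hvK : v ∉ K := fun hvK => by
      have := (hK.1 huv hm'.2.symm hne hna huK huH (.inl ⟨hvK, knownNotMem v hv hvK⟩)).2
        hF.right h.right
      exact h.cut.1.not_pattern huv hm'.2.symm hne hna huH (knownMem u' hu' this) h.right
        (.inl (knownNotMem v hv hvK))
    have hmv := (outer u v huv hu hv hw).resolve_left hvK
    have hu'K : u' ∉ K := fun hu'K => hvK <|
      (hK.1 hm'.2.symm huv hne.symm (fun h' => hna h'.symm) hu'K (knownMem u' hu' hu'K)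
        (.inl ⟨hF.right, h.right⟩)).1 huK huH
    -- The profiles of `v` and `u'` differ, hence the two are separated by `H`, and both are flipped.
    have hprof : profile G a b v ≠ profile G a b u' := fun heq => by
      have : u ∈ profile G a b u' := heq ▸ Or.inl ⟨hw, huv⟩
      rcases this with h' | h'
      · exact hna h'.2
      · exact hw.disjoint h'.1
    have hside : ¬ (v ∈ H ↔ u' ∈ H) := fun hiff => hprof (hF.profile_eq v u' hmv hm' hvK hu'K hiff)
    by_cases hvH : v ∈ H
    · have hvF : v ∈ F := by rw [mem] at hv; tauto
      have hu'F : u' ∈ F := by rw [mem] at hu'; tauto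
      exact hprof (hF.profile_eq' v u' hmv hm' hvF hu'F)
    · have hu'H : u' ∈ H := by tauto
      have : u ∈ profile G a b u' := h.profile_subset hm' hmv hu'H hvH (.inl ⟨hw, huv⟩)
      rcases this with h' | h'
      · exact hna h'.2
      · exact hw.disjoint h'.1
  intro u v u' v' hu hv hu' hv' huv hu'v' hne
  by_contra hna
  have hua : u ≠ a := by
    rintro rfl; exact hna (left u' v' hu'v' hu' hv' hne.symm)
  have hu'a : u' ≠ a := by
    rintro rfl; exact hna (left u v huv hu hv hne).symm
  have hau := left u v huv hu hv hua
  have hau' := left u' v' hu'v' hu' hv' hu'a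
  have hub : u ≠ b := by rintro rfl; exact h.right (knownMem _ hu hF.right)
  have hu'b : u' ≠ b := by rintro rfl; exact h.right (knownMem _ hu' hF.right)
  by_cases hbu : G.Adj b u <;> by_cases hbu' : G.Adj b u'
  · -- Both vertices are common neighbours, hence tied, and they stay separated.
    have h1 := h.mid_mem_iff ⟨hau, hbu⟩ ⟨hau', hbu'⟩ hne hna
    have h2 := hF.tied u u' (.inr ⟨⟨hau, hbu⟩, ⟨hau', hbu'⟩, hne, hna⟩)
    have h3 := hF.tied u' u (.inr ⟨⟨hau', hbu'⟩, ⟨hau, hbu⟩, hne.symm, fun h' => hna h'.symm⟩)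
    rw [mem] at hu hu'
    tauto
  · exact hna (wingMid u' v' u hu'v' hu' hv' ⟨hau', hbu', hu'b⟩ hu ⟨hau, hbu⟩).symm
  · exact hna (wingMid u v u' huv hu hv ⟨hau, hbu, hub⟩ hu' ⟨hau', hbu'⟩)
  · -- Both vertices are in the wing of `a`.
    have hw : Wing G a b u := ⟨hau, hbu, hub⟩
    have hw' : Wing G a b u' := ⟨hau', hbu', hu'b⟩
    have huK := h.wing_known hK hF.left hF.right hw
    have hu'K := h.wing_known hK hF.left hF.right hw'
    have huH := h.wing_mem hw
    have hu'H := h.wing_mem hw'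
    have hvK : v ∉ K := fun hvK => by
      have := (hK.1 huv hu'v' hne hna huK huH (.inl ⟨hvK, knownNotMem v hv hvK⟩)).1 hu'K hu'H
      exact h.cut.1.not_pattern huv hu'v' hne hna huH hu'H (knownNotMem v' hv' this)
        (.inl (knownNotMem v hv hvK))
    have hv'K : v' ∉ K := fun hv'K => hvK <|
      (hK.1 hu'v' huv hne.symm (fun h' => hna h'.symm) hu'K hu'H
        (.inl ⟨hv'K, knownNotMem v' hv' hv'K⟩)).1 huK huH
    have hm := (outer u v huv hu hv hw).resolve_left hvK
    have hm' := (outer u' v' hu'v' hu' hv' hw').resolve_left hv'K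
    -- A common neighbour of `u` and `u'` in the middle would be known.
    have huv' : ¬ G.Adj u v' := fun h' => hv'K <|
      (hK.1 h' hu'v' hne hna huK huH (.inr (.inl rfl))).1 hu'K hu'H
    have hu'v : ¬ G.Adj u' v := fun h' => hvK <|
      (hK.1 huv h' hne hna huK huH (.inr (.inl rfl))).1 hu'K hu'H
    have p1 : ¬ profile G a b v ⊆ profile G a b v' := fun hs => by
      rcases hs (.inl ⟨hw, huv⟩) with h' | h'
      · exact huv' h'.2
      · exact hw.disjoint h'.1
    have p2 : ¬ profile G a b v' ⊆ profile G a b v := fun hs => by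
      rcases hs (.inl ⟨hw', hu'v'⟩) with h' | h'
      · exact hu'v h'.2
      · exact hw'.disjoint h'.1
    by_cases hvH : v ∈ H <;> by_cases hv'H : v' ∈ H
    · exact p1 (hF.profile_eq v v' hm hm' hvK hv'K (by tauto)).le
    · exact p2 (h.profile_subset hm hm' hvH hv'H)
    · exact p1 (h.profile_subset hm' hm hv'H hvH)
    · exact p1 (hF.profile_eq v v' hm hm' hvK hv'K (by tauto)).le

/-- Reversing the labels on a flippable set leads to a halfspace again. -/
theorem Flippable.cliqueCut (h : CutEdge G H a b) {F : Set V} (hF : Flippable G H K a b F) :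
    CliqueCut G (symmDiff H F) := by
  refine ⟨hF.borderClique h, ?_⟩
  have : (symmDiff H F)ᶜ = symmDiff Hᶜ F := by
    ext w; simp only [Set.mem_symmDiff, Set.mem_compl_iff]; tauto
  rw [this]
  exact hF.swap.borderClique h.swap

open Relation in
/-- Unknown vertices of `H` no two of which are connected by ties can be labelled independently of
each other. -/
theorem CutEdge.exists_flip (h : CutEdge G H a b) (hK : PropClosed G H K) (ha : a ∈ K) (hb : b ∈ K)
    (hprof : ∀ c c', Mid G a b c → Mid G a b c' → c ∉ K → c' ∉ K → (c ∈ H ↔ c' ∈ H) →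
      profile G a b c = profile G a b c')
    {M T : Set V} (hM : ∀ v ∈ M, v ∈ H ∧ v ∉ K)
    (hMt : ∀ v ∈ M, ∀ w ∈ M, ReflTransGen (Tied G a b) v w → v = w) (hT : T ⊆ M) :
    ∃ H' : Set V, CliqueCut G H' ∧ M ∩ H' = T := by
  set F : Set V := {w | ∃ v ∈ M \ T, ReflTransGen (Tied G a b) v w} with hFdef
  have unknown : ∀ v, v ∉ K → ∀ w, ReflTransGen (Tied G a b) v w → w ∉ K := by
    intro v hv w hvw
    induction hvw with
    | refl => exact hv
    | tail _ ht ih => exact fun hw => ih (h.known_of_tied hK ha hb ht.symm hw)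
  have hF : Flippable G H K a b F := by
    refine ⟨hK, ha, hb, ?_, ?_, hprof, ?_⟩
    · rintro w ⟨v, hv, hvw⟩
      exact unknown v (hM v hv.1).2 w hvw
    · rintro w w' ht ⟨v, hv, hvw⟩
      exact ⟨v, hv, hvw.tail ht⟩
    · have mixed : ∀ c c', Mid G a b c → Mid G a b c' → c ∈ F → c' ∈ F → c ∈ H → c' ∉ H →
          profile G a b c = profile G a b c' := by
        rintro c c' hc hc' ⟨v, hv, hvc⟩ ⟨v', hv', hvc'⟩ hcH hc'H
        by_contra hne
        have hcK := unknown v (hM v hv.1).2 c hvc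
        have hc'K := unknown v' (hM v' hv'.1).2 c' hvc'
        -- If the profiles on the two sides differ, ties do not lead from one side to the other.
        have stay : ∀ w, ReflTransGen (Tied G a b) v' w → w ∈ H := by
          intro w hw
          induction hw with
          | refl => exact (hM v' hv'.1).1
          | @tail x y hx ht ih =>
            rcases ht with ⟨hadj, hz | hz⟩ | ⟨h1, h2, h3, h4⟩
            · exact (h.far_mem_iff hz hadj).1 ih
            · exact (h.far_mem_iff hz hadj.symm).2 ih
            · exfalso
              have hyH := h.mid_notMem h1 h2 h3 h4 ih
              have hxK := unknown v' (hM v' hv'.1).2 x hx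
              have hyK := unknown v' (hM v' hv'.1).2 y (hx.tail (.inr ⟨h1, h2, h3, h4⟩))
              have e1 := h.profile_eq_of_tied hK ha hb h1 h2 hxK hyK h4 ih hyH
              have e2 := hprof c x hc h1 hcK hxK (by tauto)
              have e3 := hprof c' y hc' h2 hc'K hyK (by tauto)
              exact hne (e2.trans (e1.trans e3.symm))
        exact hc'H (stay c' hvc')
      intro c c' hc hc' hcF hc'F
      have hK1 : c ∉ K := by
        obtain ⟨v, hv, hvc⟩ := hcF; exact unknown v (hM v hv.1).2 c hvc
      have hK2 : c' ∉ K := by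
        obtain ⟨v, hv, hvc⟩ := hc'F; exact unknown v (hM v hv.1).2 c' hvc
      by_cases h1 : c ∈ H <;> by_cases h2 : c' ∈ H
      · exact hprof c c' hc hc' hK1 hK2 (by tauto)
      · exact mixed c c' hc hc' hcF hc'F h1 h2
      · exact (mixed c' c hc' hc hc'F hcF h2 h1).symm
      · exact hprof c c' hc hc' hK1 hK2 (by tauto)
  refine ⟨symmDiff H F, hF.cliqueCut h, ?_⟩
  ext w
  simp only [Set.mem_inter_iff, Set.mem_symmDiff]
  constructor
  · rintro ⟨hw, h' | h'⟩
    · by_contra hwT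
      exact h'.2 ⟨w, ⟨hw, hwT⟩, .refl⟩
    · exact absurd (hM w hw).1 h'.2
  · intro hw
    refine ⟨hT hw, .inl ⟨(hM w (hT hw)).1, ?_⟩⟩
    rintro ⟨v, hv, hvw⟩
    exact hv.2 (hMt v hv.1 w (hT hw) hvw ▸ hw)

theorem exists_cutEdge (hG : G.Connected) (hH : CliqueCut G H) {x y : V} (hx : x ∈ H) (hy : y ∉ H) :
    ∃ a b, CutEdge G H a b := by
  obtain ⟨p⟩ := hG.preconnected x y
  obtain ⟨d, -, hd, hd'⟩ := p.exists_boundary_dart H hx hy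
  exact ⟨d.fst, d.snd, hH, d.adj, hd, hd'⟩

theorem HalfClosed.sInter {𝒦 : Set (Set V)} (h : ∀ K ∈ 𝒦, HalfClosed G H K) :
    HalfClosed G H (⋂₀ 𝒦) := fun _ _ _ _ huv hu'v' hne hna hu huH hv =>
  ⟨fun hu' hu'H K hK => (h K hK huv hu'v' hne hna (hu K hK) huH
      (hv.imp_left fun h' => ⟨h'.1 K hK, h'.2⟩)).1 (hu' K hK) hu'H,
    fun hv' hv'H K hK => (h K hK huv hu'v' hne hna (hu K hK) huH
      (hv.imp_left fun h' => ⟨h'.1 K hK, h'.2⟩)).2 (hv' K hK) hv'H⟩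

open Relation in
/-- The structure theorem behind the experts. For every nontrivial halfspace `H` there are four vertices
such that, once their labels are known, the unknown vertices fall into classes (of the
symmetric relation `R`) each of which becomes known as soon as one of its members is,
and at most `d` of these classes contain vertices of `H` that are not determined by the four vertices,
where `d` is the VC-dimension. -/
theorem exists_good_vertices [Fintype V] [DecidableEq V] (hG : G.Connected) (hH : CliqueCut G H) {x y : V}
    (hx : x ∈ H) (hy : y ∉ H) :
    ∃ a ∈ H, ∃ c₁ ∈ H, ∃ b ∉ H, ∃ c₂ ∉ H, ∃ R : V → V → Prop, (∀ v w, R v w → R w v) ∧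
      (∀ K, PropClosed G H K → a ∈ K → b ∈ K → ∀ v w, R v w → v ∈ K → w ∈ K) ∧
      ∀ M : Finset V,
        (∀ v ∈ M, v ∈ H ∧ ∃ K, PropClosed G H K ∧ a ∈ K ∧ c₁ ∈ K ∧ b ∈ K ∧ c₂ ∈ K ∧ v ∉ K) →
        (∀ v ∈ M, ∀ w ∈ M, R v w → v = w) → M.card ≤ (mHalfspaces G).vcDim := by
  classical
  obtain ⟨a, b, h⟩ := exists_cutEdge hG hH hx hy
  obtain ⟨c₁, hc₁, c₂, hc₂, hguess⟩ := h.exists_guess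
  refine ⟨a, h.left, c₁, hc₁, b, h.right, c₂, hc₂, ReflTransGen (Tied G a b),
    fun v w hvw => ?_, ?_, ?_⟩
  · induction hvw with
    | refl => exact .refl
    | tail _ ht ih => exact .head ht.symm ih
  · intro K hK ha hb v w hvw hv
    induction hvw with
    | refl => exact hv
    | tail _ ht ih => exact h.known_of_tied hK ha hb ht ih
  · intro M hM hMt
    -- What the four vertices determine is the least closed set that contains them.
    set 𝒦 : Set (Set V) := {K | PropClosed G H K ∧ a ∈ K ∧ c₁ ∈ K ∧ b ∈ K ∧ c₂ ∈ K}
    have hK : PropClosed G H (⋂₀ 𝒦) :=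
      ⟨HalfClosed.sInter fun K hK => hK.1.1, HalfClosed.sInter fun K hK => hK.1.2⟩
    have ha : a ∈ ⋂₀ 𝒦 := fun K hK => hK.2.1
    have h₁ : c₁ ∈ ⋂₀ 𝒦 := fun K hK => hK.2.2.1
    have hb : b ∈ ⋂₀ 𝒦 := fun K hK => hK.2.2.2.1
    have h₂ : c₂ ∈ ⋂₀ 𝒦 := fun K hK => hK.2.2.2.2
    have hM' : ∀ v ∈ M, v ∈ H ∧ v ∉ ⋂₀ 𝒦 := fun v hv => by
      obtain ⟨hvH, K, hK, k1, k2, k3, k4, hvK⟩ := hM v hv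
      exact ⟨hvH, fun h' => hvK (h' K ⟨hK, k1, k2, k3, k4⟩)⟩
    have : (mHalfspaces G).Shatters M := by
      intro T hT
      obtain ⟨H', hH', hMH'⟩ := h.exists_flip hK ha hb (hguess _ hK ha hb h₁ h₂) (M := M) (T := T)
        (by simpa using hM') (by simpa using hMt) (by simpa using hT)
      refine ⟨H'.toFinset, (mem_mHalfspaces_iff hG).2 (by simpa using hH'), ?_⟩
      ext w
      have := Set.ext_iff.1 hMH' w
      simpa using this
    exact this.card_le_vcDim

theorem cliqueCut_empty : CliqueCut G ∅ :=
  ⟨fun _ _ _ _ h => h.elim, fun _ _ _ _ _ h => (h fun h' => h').elim⟩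

theorem cliqueCut_univ : CliqueCut G Set.univ := by
  have := (cliqueCut_empty (G := G)).compl
  rwa [Set.compl_empty] at this

/-- The empty set and the set of all vertices are halfspaces and shatter every single vertex. -/
theorem one_le_vcDim [Fintype V] [DecidableEq V] (hG : G.Connected) : 1 ≤ (mHalfspaces G).vcDim := by
  obtain ⟨v⟩ := hG.nonempty
  have : (mHalfspaces G).Shatters {v} := by
    intro T hT
    rcases Finset.subset_singleton_iff.1 hT with rfl | rfl
    · exact ⟨∅, (mem_mHalfspaces_iff hG).2 (by simpa using cliqueCut_empty), by simp⟩
    · exact ⟨Finset.univ, (mem_mHalfspaces_iff hG).2 (by simpa using cliqueCut_univ), by simp⟩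
  simpa using this.card_le_vcDim

end Propagation

/-! ### Labellings and their propagation -/

section Labels

variable {n : ℕ} {G : SimpleGraph (Fin n)} {L L' L'' : ℕ → ℕ} {H : Set (Fin n)}

/-- All known labels agree with `H`. In a labelling, `1` stands for membership in the halfspace, `2` for
non-membership and `0` for unknown. -/
def Agrees (H : Set (Fin n)) (L : ℕ → ℕ) : Prop :=
  ∀ v : Fin n, L v = 0 ∨ v ∈ H ∧ L v = 1 ∨ v ∉ H ∧ L v = 2

/-- The premise of an inference by propagation, from the point of view of the label `σ`. -/
def Fires (G : SimpleGraph (Fin n)) (L : ℕ → ℕ) (σ : ℕ) (u v u' v' : Fin n) : Prop :=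
  G.Adj u v ∧ G.Adj u' v' ∧ u ≠ u' ∧ ¬ G.Adj u u' ∧ L u = σ ∧
    (L v = 3 - σ ∨ v = v' ∨ G.Adj v v' ∧ ¬ G.Adj v u')

/-- No new label can be inferred at the given four vertices. -/
def StableAt (G : SimpleGraph (Fin n)) (L : ℕ → ℕ) (σ : ℕ) (u v u' v' : Fin n) : Prop :=
  Fires G L σ u v u' v' → (L u' = σ → L v' ≠ 0) ∧ (L v' = 3 - σ → L u' ≠ 0)

/-- No new label can be inferred by a single step of propagation. -/
def Stable (G : SimpleGraph (Fin n)) (L : ℕ → ℕ) : Prop :=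
  ∀ u v u' v', StableAt G L 1 u v u' v' ∧ StableAt G L 2 u v u' v'

/-- The number of vertices without a label. -/
def unlabelled (n : ℕ) (L : ℕ → ℕ) : ℕ := (Finset.univ.filter fun v : Fin n => L v = 0).card

/-- The labelling `L'` arises from `L` by propagation. -/
structure Derives (G : SimpleGraph (Fin n)) (L L' : ℕ → ℕ) : Prop where
  mono : ∀ i, L i ≠ 0 → L' i = L i
  sound : ∀ H, CliqueCut G H → Agrees H L → Agrees H L'
  strict : L' = L ∨ ¬ Stable G L ∧ unlabelled n L' < unlabelled n L

theorem Derives.refl (G : SimpleGraph (Fin n)) (L : ℕ → ℕ) : Derives G L L :=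
  ⟨fun _ _ => rfl, fun _ _ h => h, .inl rfl⟩

theorem Derives.unlabelled_le (h : Derives G L L') : unlabelled n L' ≤ unlabelled n L := by
  rcases h.strict with rfl | h
  exacts [le_rfl, h.2.le]

theorem Derives.trans (h : Derives G L L') (h' : Derives G L' L'') : Derives G L L'' where
  mono i hi := (h'.mono i (by rwa [h.mono i hi])).trans (h.mono i hi)
  sound H hH hL := h'.sound H hH (h.sound H hH hL)
  strict := by
    rcases h.strict with rfl | h1
    · exact h'.strict
    · exact .inr ⟨h1.1, h'.unlabelled_le.trans_lt h1.2⟩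

theorem Derives.antisymm (h : Derives G L L') (h' : Derives G L' L'') (he : L'' = L) :
    L' = L := by
  rcases h.strict with h1 | h1
  · exact h1
  · exact absurd h'.unlabelled_le (by rw [he]; omega)

theorem Agrees.mem_of_eq_one {v : Fin n} (h : Agrees H L) (hv : L v = 1) : v ∈ H := by
  rcases h v with h | h | h
  · omega
  · exact h.1
  · omega

theorem Agrees.notMem_of_eq_two {v : Fin n} (h : Agrees H L) (hv : L v = 2) : v ∉ H := by
  rcases h v with h | h | h
  · omega
  · omega
  · exact h.1

theorem Agrees.update {v : Fin n} {k : ℕ} (h : Agrees H L) (hk : v ∈ H ∧ k = 1 ∨ v ∉ H ∧ k = 2) :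
    Agrees H (Function.update L v k) := by
  intro w
  by_cases hw : w = v
  · subst hw; simpa using Or.inr hk
  · rw [Function.update_of_ne (by simpa [Fin.ext_iff] using hw)]; exact h w

/-- The set that contains the vertices labelled `σ` and avoids those labelled `3 - σ`. -/
def side (σ : ℕ) (H : Set (Fin n)) : Set (Fin n) := if σ = 1 then H else Hᶜ

theorem not_fires (hH : CliqueCut G H) (hL : Agrees H L) {σ : ℕ} (hσ : σ = 1 ∨ σ = 2)
    {u v u' v' : Fin n} (h : Fires G L σ u v u' v') (hu' : u' ∈ side σ H) (hv' : v' ∉ side σ H) :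
    False := by
  obtain ⟨h1, h2, h3, h4, h5, h6⟩ := h
  rcases hσ with rfl | rfl
  · exact hH.1.not_pattern h1 h2 h3 h4 (hL.mem_of_eq_one h5) hu' hv'
      (h6.imp_left fun h => hL.notMem_of_eq_two h)
  · exact hH.2.not_pattern h1 h2 h3 h4 (hL.notMem_of_eq_two h5) hu' hv'
      (h6.imp_left fun h h' => h' (hL.mem_of_eq_one h))

theorem Agrees.label_of_mem_side {v : Fin n} {σ : ℕ} (hσ : σ = 1 ∨ σ = 2) (h : v ∈ side σ H) :
    v ∈ H ∧ σ = 1 ∨ v ∉ H ∧ σ = 2 := by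
  rcases hσ with rfl | rfl
  · exact .inl ⟨h, rfl⟩
  · exact .inr ⟨h, rfl⟩

theorem Agrees.label_of_notMem_side {v : Fin n} {σ : ℕ} (hσ : σ = 1 ∨ σ = 2) (h : v ∉ side σ H) :
    v ∈ H ∧ 3 - σ = 1 ∨ v ∉ H ∧ 3 - σ = 2 := by
  rcases hσ with rfl | rfl
  · exact .inr ⟨h, rfl⟩
  · exact .inl ⟨not_not.1 h, rfl⟩

theorem Agrees.mem_side {v : Fin n} {σ : ℕ} (hσ : σ = 1 ∨ σ = 2) (h : Agrees H L) (hv : L v = σ) :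
    v ∈ side σ H := by
  rcases hσ with rfl | rfl
  · exact h.mem_of_eq_one hv
  · exact h.notMem_of_eq_two hv

theorem Agrees.notMem_side {v : Fin n} {σ : ℕ} (hσ : σ = 1 ∨ σ = 2) (h : Agrees H L)
    (hv : L v = 3 - σ) : v ∉ side σ H := by
  rcases hσ with rfl | rfl
  · exact h.notMem_of_eq_two hv
  · exact fun h' => h' (h.mem_of_eq_one hv)

theorem Derives.update {i : Fin n} {k : ℕ} (hi : L i = 0) (hk : k ≠ 0) (hS : ¬ Stable G L)
    (hs : ∀ H, CliqueCut G H → Agrees H L → i ∈ H ∧ k = 1 ∨ i ∉ H ∧ k = 2) :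
    Derives G L (Function.update L i k) where
  mono j hj := Function.update_of_ne (by rintro rfl; exact hj hi) _ _
  sound H hH hL := hL.update (hs H hH hL)
  strict := by
    refine .inr ⟨hS, Finset.card_lt_card ⟨fun v hv => ?_, fun hsub => ?_⟩⟩
    · simp only [Finset.mem_filter, Finset.mem_univ, true_and] at hv ⊢
      by_cases hvi : v = i
      · rw [hvi]; exact hi
      · rwa [Function.update_of_ne (by simpa [Fin.ext_iff] using hvi)] at hv
    · have := hsub (show i ∈ _ by simpa using hi)
      simp [hk] at this

/-- In a stable labelling the set of labelled vertices is closed under propagation. -/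
theorem Stable.propClosed (hS : Stable G L) (hL : Agrees H L) :
    PropClosed G H {v : Fin n | L v ≠ 0} := by
  have one : ∀ v : Fin n, L v ≠ 0 → v ∈ H → L v = 1 := fun v h0 hv => by
    rcases hL v with h | h | h
    exacts [absurd h h0, h.2, absurd hv h.1]
  have two : ∀ v : Fin n, L v ≠ 0 → v ∉ H → L v = 2 := fun v h0 hv => by
    rcases hL v with h | h | h
    exacts [absurd h h0, absurd h.1 hv, h.2]
  constructor
  · intro u v u' v' h1 h2 h3 h4 h5 h6 h7
    have := (hS u v u' v').1 ⟨h1, h2, h3, h4, one u h5 h6, h7.imp_left fun h => two v h.1 h.2⟩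
    exact ⟨fun k1 k2 => this.1 (one _ k1 k2), fun k1 k2 => this.2 (two _ k1 k2)⟩
  · intro u v u' v' h1 h2 h3 h4 h5 h6 h7
    have := (hS u v u' v').2 ⟨h1, h2, h3, h4, two u h5 h6,
      h7.imp_left fun h => one v h.1 (not_not.1 h.2)⟩
    exact ⟨fun k1 k2 => this.1 (two _ k1 k2), fun k1 k2 => this.2 (one _ k1 (not_not.1 k2))⟩

end Labels

/-! ### Building blocks of the programs -/

/-- An expression that vanishes if and only if `e` and `f` have the same value. -/
def neqE (e f : Expr) : Expr := .add (.sub e f) (.sub f e)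

/-- The minimum of two expressions, which vanishes if and only if one of them does. -/
def minE (e f : Expr) : Expr := .sub e (.sub e f)

/-- The entry of the adjacency matrix at row `i` and column `j`. -/
def adjE (i j : Expr) : Expr := .get 0 (.add (.mul i (.reg 0)) j)

/-- The value of `e` divided `k` times by `n`. -/
def shiftE (e : Expr) : ℕ → Expr
  | 0 => e
  | k + 1 => .div (shiftE e k) (.reg 0)

/-- The digit number `k` of the content of register `y` to the base `n`. -/
def digitE (y k : ℕ) : Expr :=
  .sub (shiftE (.reg y) k) (.mul (.div (shiftE (.reg y) k) (.reg 0)) (.reg 0))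

/-- The digit number `k` of `e` to the base `n`. -/
def digit (n k e : ℕ) : ℕ := e / n ^ k % n

theorem neqE_eval_eq_zero {e f : Expr} {s : Memory} : (neqE e f).eval s = 0 ↔ e.eval s = f.eval s := by
  simp only [neqE, Expr.eval]; omega

theorem minE_eval_eq_zero {e f : Expr} {s : Memory} :
    (minE e f).eval s = 0 ↔ e.eval s = 0 ∨ f.eval s = 0 := by
  simp only [minE, Expr.eval]; omega

theorem shiftE_eval {e : Expr} {s : Memory} (k : ℕ) :
    (shiftE e k).eval s = e.eval s / s.reg 0 ^ k := by
  induction k with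
  | zero => simp [shiftE]
  | succ k ih => simp only [shiftE, Expr.eval, ih, Nat.div_div_eq_div_mul, pow_succ]

theorem digitE_eval {s : Memory} (y k : ℕ) :
    (digitE y k).eval s = digit (s.reg 0) k (s.reg y) := by
  simp only [digitE, Expr.eval, shiftE_eval, digit]
  rw [Nat.mod_eq_sub_mul_div, mul_comm]

theorem digit_lt {n k e : ℕ} (hn : 0 < n) : digit n k e < n := Nat.mod_lt _ hn

theorem exists_digits {n g₀ g₁ g₂ g₃ : ℕ} (h₀ : g₀ < n) (h₁ : g₁ < n) (h₂ : g₂ < n) (h₃ : g₃ < n) :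
    ∃ e < n ^ 4, digit n 0 e = g₀ ∧ digit n 1 e = g₁ ∧ digit n 2 e = g₂ ∧ digit n 3 e = g₃ := by
  have hn : 0 < n := by omega
  have step : ∀ {a q m : ℕ}, a < n → q < m → a + n * q < n * m := fun {a q m} ha hq => by
    calc a + n * q < n + n * q := by omega
      _ = n * (q + 1) := by ring
      _ ≤ n * m := Nat.mul_le_mul_left n hq
  have d : ∀ a q, a < n → (a + n * q) / n = q := fun a q ha => by
    rw [Nat.add_mul_div_left _ _ hn, Nat.div_eq_of_lt ha, zero_add]
  refine ⟨g₀ + n * (g₁ + n * (g₂ + n * g₃)), ?_, ?_, ?_, ?_, ?_⟩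
  · have := step h₀ (step h₁ (step h₂ h₃))
    calc _ < n * (n * (n * n)) := this
      _ = n ^ 4 := by ring
  · simp [digit, Nat.add_mul_mod_self_left, Nat.mod_eq_of_lt h₀]
  · rw [digit, pow_one, d _ _ h₀, Nat.add_mul_mod_self_left, Nat.mod_eq_of_lt h₁]
  · rw [digit, pow_two, ← Nat.div_div_eq_div_mul, d _ _ h₀, d _ _ h₁, Nat.add_mul_mod_self_left,
      Nat.mod_eq_of_lt h₂]
  · rw [digit, pow_succ, pow_two, ← Nat.div_div_eq_div_mul, ← Nat.div_div_eq_div_mul, d _ _ h₀,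
      d _ _ h₁, d _ _ h₂, Nat.mod_eq_of_lt h₃]

/-- An expression that vanishes if and only if a propagation step for the label `σ` applies to the
vertices in the registers `8`, …, `11`. -/
def firesE (σ : ℕ) : Expr :=
  .add (.sub (.lit 1) (adjE (.reg 8) (.reg 9))) (.add (.sub (.lit 1) (adjE (.reg 10) (.reg 11)))
    (.add (.sub (.lit 1) (neqE (.reg 8) (.reg 10))) (.add (adjE (.reg 8) (.reg 10))
      (.add (neqE (.get 2 (.reg 8)) (.lit σ))
        (minE (neqE (.get 2 (.reg 9)) (.lit (3 - σ))) (minE (neqE (.reg 9) (.reg 11))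
          (.add (.sub (.lit 1) (adjE (.reg 9) (.reg 11))) (adjE (.reg 9) (.reg 10)))))))))

/-- A propagation step at the vertices in the registers `8`, …, `11`. -/
def inferC (σ : ℕ) : Code :=
  .ite (firesE σ) .skip (.seq
    (.ite (.add (neqE (.get 2 (.reg 10)) (.lit σ)) (.get 2 (.reg 11))) .skip
      (.put 2 (.reg 11) (.lit σ)))
    (.ite (.add (neqE (.get 2 (.reg 11)) (.lit (3 - σ))) (.get 2 (.reg 10))) .skip
      (.put 2 (.reg 10) (.lit (3 - σ)))))

/-- Decode the number in register `7` into four vertices. -/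
def decodeC : Code :=
  .seq (.assign 8 (digitE 7 0)) (.seq (.assign 9 (digitE 7 1))
    (.seq (.assign 10 (digitE 7 2)) (.assign 11 (digitE 7 3))))

/-- Propagation steps at all quadruples of vertices. -/
def sweepC : Code := .loop 7 4 (.seq decodeC (.seq (inferC 1) (inferC 2)))

/-- Propagation to the end: every sweep that changes something labels a further vertex. -/
def propagateC : Code := .loop 6 0 sweepC

/-- The memory contains the graph, the number of its vertices and the fourth power of this number. -/
structure Holds {n : ℕ} (G : SimpleGraph (Fin n)) (s : Memory) : Prop where
  reg_zero : s.reg 0 = n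
  reg_four : s.reg 4 = n ^ 4
  arr_zero : s.arr 0 = (inputMemory G).arr 0

section Propagate

variable {n : ℕ} {G : SimpleGraph (Fin n)}

open Classical in
theorem inputMemory_adj (i j : Fin n) :
    (inputMemory G).arr 0 (i * n + j) = if G.Adj i j then 1 else 0 := by
  simp only [inputMemory, Function.update_self]
  congr 1
  rw [eq_iff_iff]
  constructor
  · rintro ⟨i', j', h, he⟩
    have hn : 0 < n := i.pos
    have e1 : (i : ℕ) = i' := by
      have := congrArg (· / n) he
      simpa [add_comm, Nat.add_mul_div_right _ _ hn, Nat.div_eq_of_lt j.2, Nat.div_eq_of_lt j'.2]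
        using this
    have e2 : (j : ℕ) = j' := by rw [e1] at he; omega
    rwa [Fin.ext e1, Fin.ext e2]
  · exact fun h => ⟨i, j, h, rfl⟩

theorem Holds.run {s : Memory} (h : Holds G s) {P : Code} (h0 : P.writesReg 0 = false)
    (h4 : P.writesReg 4 = false) (ha : P.writesArr 0 = false) : Holds G (P.run s) :=
  ⟨(P.run_reg h0 s).trans h.1, (P.run_reg h4 s).trans h.2, (P.run_arr ha s).trans h.3⟩

theorem Holds.setReg {s : Memory} (h : Holds G s) {x k : ℕ} (h0 : x ≠ 0) (h4 : x ≠ 4) :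
    Holds G (s.setReg x k) :=
  ⟨by simp [Memory.setReg, h0.symm, h.1], by simp [Memory.setReg, h4.symm, h.2], h.3⟩

open Classical in
theorem Holds.adjE_eval {s : Memory} (h : Holds G s) {x y : ℕ} {i j : Fin n} (hx : s.reg x = i)
    (hy : s.reg y = j) : (adjE (.reg x) (.reg y)).eval s = if G.Adj i j then 1 else 0 := by
  simp only [adjE, Expr.eval, hx, hy, h.1, h.3, inputMemory_adj]

theorem firesE_eval_eq_zero {s : Memory} (h : Holds G s) {σ : ℕ} {u v u' v' : Fin n}
    (hu : s.reg 8 = u) (hv : s.reg 9 = v) (hu' : s.reg 10 = u') (hv' : s.reg 11 = v') :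
    (firesE σ).eval s = 0 ↔ Fires G (s.arr 2) σ u v u' v' := by
  classical
  have h1 := h.adjE_eval hu hv
  have h2 := h.adjE_eval hu' hv'
  have h3 := h.adjE_eval hu hu'
  have h4 := h.adjE_eval hv hv'
  have h5 := h.adjE_eval hv hu'
  have e1 : (neqE (.reg 8) (.reg 10)).eval s = 0 ↔ u = u' := by
    rw [neqE_eval_eq_zero]; simp [Expr.eval, hu, hu', Fin.ext_iff]
  have e2 : (neqE (.reg 9) (.reg 11)).eval s = 0 ↔ v = v' := by
    rw [neqE_eval_eq_zero]; simp [Expr.eval, hv, hv', Fin.ext_iff]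
  have e3 : (neqE (.get 2 (.reg 8)) (.lit σ)).eval s = 0 ↔ s.arr 2 u = σ := by
    rw [neqE_eval_eq_zero]; simp [Expr.eval, hu]
  have e4 : (neqE (.get 2 (.reg 9)) (.lit (3 - σ))).eval s = 0 ↔ s.arr 2 v = 3 - σ := by
    rw [neqE_eval_eq_zero]; simp [Expr.eval, hv]
  have a1 : ∀ p : Prop, [Decidable p] → ((1 - if p then 1 else 0) = 0 ↔ p) := fun p _ => by
    split_ifs <;> simp_all
  have a2 : ∀ p : Prop, [Decidable p] → ((if p then 1 else 0) = 0 ↔ ¬ p) := fun p _ => by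
    split_ifs <;> simp_all
  have a3 : 1 - (neqE (.reg 8) (.reg 10)).eval s = 0 ↔ u ≠ u' := by
    rw [Ne, ← e1]; omega
  simp only [firesE, Expr.eval, Nat.add_eq_zero_iff, minE_eval_eq_zero, e2, e3, e4, h1, h2, h3, h4, h5,
    a1, a2, a3, Fires]

/-- The effect of a propagation step. -/
theorem inferC_run {s : Memory} (h : Holds G s) {σ : ℕ} (hσ : σ = 1 ∨ σ = 2) {u v u' v' : Fin n}
    (hu : s.reg 8 = u) (hv : s.reg 9 = v) (hu' : s.reg 10 = u') (hv' : s.reg 11 = v') :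
    Derives G (s.arr 2) (((inferC σ).run s).arr 2) ∧
      (((inferC σ).run s).arr 2 = s.arr 2 → StableAt G (s.arr 2) σ u v u' v') := by
  have hσ0 : σ ≠ 0 := by omega
  have hσ3 : 3 - σ ≠ 0 := by omega
  have hσσ : σ ≠ 3 - σ := by omega
  by_cases hf : Fires G (s.arr 2) σ u v u' v'
  swap
  · have h0 := (firesE_eval_eq_zero h hu hv hu' hv' (σ := σ)).not.2 hf
    have : (inferC σ).run s = s := by simp only [inferC, Code.run, if_pos h0]
    rw [this]
    exact ⟨.refl G _, fun _ hf' => absurd hf' hf⟩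
  have h0 := (firesE_eval_eq_zero h hu hv hu' hv' (σ := σ)).2 hf
  have t1 : ∀ s : Memory, s.reg 10 = u' → s.reg 11 = v' →
      ((Expr.add (neqE (.get 2 (.reg 10)) (.lit σ)) (.get 2 (.reg 11))).eval s = 0 ↔
        s.arr 2 u' = σ ∧ s.arr 2 v' = 0) := fun s h1 h2 => by
    simp only [Expr.eval, Nat.add_eq_zero_iff, neqE_eval_eq_zero, h1, h2]
  have t2 : ∀ s : Memory, s.reg 10 = u' → s.reg 11 = v' →
      ((Expr.add (neqE (.get 2 (.reg 11)) (.lit (3 - σ))) (.get 2 (.reg 10))).eval s = 0 ↔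
        s.arr 2 v' = 3 - σ ∧ s.arr 2 u' = 0) := fun s h1 h2 => by
    simp only [Expr.eval, Nat.add_eq_zero_iff, neqE_eval_eq_zero, h1, h2]
  by_cases c1 : s.arr 2 u' = σ ∧ s.arr 2 v' = 0
  · have hr : ((inferC σ).run s).arr 2 = Function.update (s.arr 2) v' σ := by
      have k1 := (t1 s hu' hv').2 c1
      have k2 := (t2 (s.setArr 2 v' σ) hu' hv').not.2 (by simp [Memory.setArr, hσσ])
      simp only [inferC, Code.run, h0, k1, ne_eq, not_true_eq_false, if_false]
      rw [if_pos]
      · simp [Memory.setArr, Expr.eval, hv']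
      · simpa [Expr.eval, hv'] using k2
    rw [hr]
    refine ⟨.update c1.2 hσ0 (fun hS => ?_) fun H hH hL => Agrees.label_of_mem_side hσ ?_, fun he => ?_⟩
    · rcases hσ with rfl | rfl
      · exact ((hS u v u' v').1 hf).1 c1.1 c1.2
      · exact ((hS u v u' v').2 hf).1 c1.1 c1.2
    · by_contra hc
      exact not_fires hH hL hσ hf (hL.mem_side hσ c1.1) hc
    · have := congrFun he v'
      simp [c1.2, hσ0] at this
  · have k1 := (t1 s hu' hv').not.2 c1
    by_cases c2 : s.arr 2 v' = 3 - σ ∧ s.arr 2 u' = 0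
    · have hr : ((inferC σ).run s).arr 2 = Function.update (s.arr 2) u' (3 - σ) := by
        have k2 := (t2 s hu' hv').2 c2
        simp only [inferC, Code.run, h0, ne_eq, not_true_eq_false, if_false, if_pos k1, k2]
        simp [Memory.setArr, Expr.eval, hu']
      rw [hr]
      refine ⟨.update c2.2 hσ3 (fun hS => ?_) fun H hH hL => Agrees.label_of_notMem_side hσ fun hc => ?_,
        fun he => ?_⟩
      · rcases hσ with rfl | rfl
        · exact ((hS u v u' v').1 hf).2 c2.1 c2.2
        · exact ((hS u v u' v').2 hf).2 c2.1 c2.2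
      · exact not_fires hH hL hσ hf hc (hL.notMem_side hσ c2.1)
      · have := congrFun he u'
        simp [c2.2, hσ3] at this
    · have k2 := (t2 s hu' hv').not.2 c2
      have hr : (inferC σ).run s = s := by
        simp only [inferC, Code.run, h0, ne_eq, not_true_eq_false, if_false, if_pos k1, if_pos k2]
      rw [hr]
      exact ⟨.refl G _, fun _ _ => ⟨fun e1 e2 => c1 ⟨e1, e2⟩, fun e1 e2 => c2 ⟨e1, e2⟩⟩⟩

theorem decodeC_run {s : Memory} (h : Holds G s) {q : ℕ} (hq : s.reg 7 = q) :
    (decodeC.run s).reg 8 = digit n 0 q ∧ (decodeC.run s).reg 9 = digit n 1 q ∧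
      (decodeC.run s).reg 10 = digit n 2 q ∧ (decodeC.run s).reg 11 = digit n 3 q := by
  simp [decodeC, Code.run, Memory.setReg, digitE_eval, hq, h.1]

theorem sweepC_run {s : Memory} (h : Holds G s) (hn : 0 < n) :
    Derives G (s.arr 2) ((sweepC.run s).arr 2) ∧
      ((sweepC.run s).arr 2 = s.arr 2 → Stable G (s.arr 2)) := by
  have key := Code.run_loop (x := 7) (y := 4) (s := s) (N := n ^ 4)
    (P := .seq decodeC (.seq (inferC 1) (inferC 2)))
    h.reg_four (by decide)
    (fun i s' => Holds G s' ∧ Derives G (s.arr 2) (s'.arr 2) ∧ (s'.arr 2 = s.arr 2 →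
      ∀ q < i, ∀ u v u' v' : Fin n, digit n 0 q = u → digit n 1 q = v → digit n 2 q = u' →
        digit n 3 q = v' → StableAt G (s.arr 2) 1 u v u' v' ∧ StableAt G (s.arr 2) 2 u v u' v'))
    ⟨h.setReg (by decide) (by decide), .refl G _, fun _ q hq => absurd hq (by omega)⟩ ?_
  · obtain ⟨-, k2, k3⟩ := key
    refine ⟨k2, fun he u v u' v' => ?_⟩
    obtain ⟨q, hq, e0, e1, e2, e3⟩ := exists_digits u.2 v.2 u'.2 v'.2
    exact k3 he q hq u v u' v' e0 e1 e2 e3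
  · rintro i hi s₀ hx ⟨hH, hD, hS⟩
    rw [show (Code.seq decodeC (.seq (inferC 1) (inferC 2))).run s₀ =
      (inferC 2).run ((inferC 1).run (decodeC.run s₀)) from rfl]
    obtain ⟨r8, r9, r10, r11⟩ := decodeC_run hH hx
    have hH₁ : Holds G (decodeC.run s₀) := hH.run (by decide) (by decide) (by decide)
    have a₁ : (decodeC.run s₀).arr 2 = s₀.arr 2 := Code.run_arr _ (by decide) _
    generalize decodeC.run s₀ = s₁ at *
    set u : Fin n := ⟨digit n 0 i, digit_lt hn⟩
    set v : Fin n := ⟨digit n 1 i, digit_lt hn⟩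
    set u' : Fin n := ⟨digit n 2 i, digit_lt hn⟩
    set v' : Fin n := ⟨digit n 3 i, digit_lt hn⟩
    obtain ⟨d1, t1⟩ := inferC_run hH₁ (σ := 1) (.inl rfl) (u := u) (v := v) (u' := u') (v' := v')
      r8 r9 r10 r11
    have hH₂ : Holds G ((inferC 1).run s₁) := hH₁.run (by decide) (by decide) (by decide)
    obtain ⟨d2, t2⟩ := inferC_run hH₂ (σ := 2) (.inr rfl) (u := u) (v := v) (u' := u') (v' := v')
      ((Code.run_reg _ (by decide) _).trans r8) ((Code.run_reg _ (by decide) _).trans r9)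
      ((Code.run_reg _ (by decide) _).trans r10) ((Code.run_reg _ (by decide) _).trans r11)
    generalize (inferC 1).run s₁ = s₂ at *
    have hH₃ : Holds G ((inferC 2).run s₂) := hH₂.run (by decide) (by decide) (by decide)
    generalize (inferC 2).run s₂ = s₃ at *
    rw [a₁] at d1 t1
    refine ⟨hH₃.setReg (by decide) (by decide), hD.trans (d1.trans d2), fun he q hq => ?_⟩
    -- If nothing has changed in the end, then nothing has changed in between.
    have he' : s₃.arr 2 = s.arr 2 := he
    have e0 : s₀.arr 2 = s.arr 2 := hD.antisymm (d1.trans d2) he'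
    have e2 : s₂.arr 2 = s₀.arr 2 := d1.antisymm d2 (he'.trans e0.symm)
    rcases Nat.lt_succ_iff_lt_or_eq.1 hq with hq | rfl
    · exact hS e0 q hq
    · intro w x w' x' ew ex ew' ex'
      have : u = w ∧ v = x ∧ u' = w' ∧ v' = x' :=
        ⟨Fin.ext ew, Fin.ext ex, Fin.ext ew', Fin.ext ex'⟩
      obtain ⟨rfl, rfl, rfl, rfl⟩ := this
      have k1 := t1 e2
      have k2 := t2 (he'.trans (e2.trans e0).symm)
      rw [e2] at k2
      rw [e0] at k1 k2
      exact ⟨k1, k2⟩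

theorem propagateC_run {s : Memory} (h : Holds G s) (hn : 0 < n) :
    Derives G (s.arr 2) ((propagateC.run s).arr 2) ∧ Stable G ((propagateC.run s).arr 2) := by
  have key := Code.run_loop (x := 6) (y := 0) (s := s) (N := n) (P := sweepC)
    h.reg_zero (by decide)
    (fun i s' => Holds G s' ∧ Derives G (s.arr 2) (s'.arr 2) ∧
      (Stable G (s'.arr 2) ∨ unlabelled n (s'.arr 2) + i ≤ n))
    ⟨h.setReg (by decide) (by decide), .refl G _, .inr ?_⟩ ?_
  · obtain ⟨-, k2, k3⟩ := key
    refine ⟨k2, k3.elim id fun h0 u v u' v' => ?_⟩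
    -- If no vertex is unlabelled, the labelling is stable.
    have hall : ∀ w : Fin n, (propagateC.run s).arr 2 w ≠ 0 := fun w hw => by
      have : unlabelled n ((propagateC.run s).arr 2) ≠ 0 :=
        Finset.card_ne_zero_of_mem (a := w) (by simpa using hw)
      have h0' : unlabelled n ((propagateC.run s).arr 2) + n ≤ n := h0
      omega
    exact ⟨fun _ => ⟨fun _ => hall _, fun _ => hall _⟩, fun _ => ⟨fun _ => hall _, fun _ => hall _⟩⟩
  · exact (Nat.add_zero _).trans_le ((Finset.card_le_univ _).trans (Fintype.card_fin n).le)
  · rintro i hi s₀ - ⟨hH, hD, hS⟩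
    obtain ⟨d, t⟩ := sweepC_run hH hn
    refine ⟨(hH.run (by decide) (by decide) (by decide)).setReg (by decide) (by decide),
      hD.trans d, ?_⟩
    change Stable G ((sweepC.run s₀).arr 2) ∨ unlabelled n ((sweepC.run s₀).arr 2) + (i + 1) ≤ n
    by_cases hst : Stable G (s₀.arr 2)
    · rcases d.strict with he | he
      · exact .inl (he ▸ hst)
      · exact absurd hst he.1
    · have := hS.resolve_left hst
      rcases d.strict with he | he
      · exact absurd (t he) hst
      · exact .inr (by omega)

end Propagate

/-! ### The learner -/

/-- Label the four vertices that are the digits of the number of the expert, in register `5`: two with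
the default label `1 + δ` and two with the opposite label. -/
def guessC (δ : ℕ) : Code :=
  .seq (.put 2 (digitE 5 2) (.lit (2 - δ))) (.seq (.put 2 (digitE 5 3) (.lit (2 - δ)))
    (.seq (.put 2 (digitE 5 0) (.lit (1 + δ))) (.put 2 (digitE 5 1) (.lit (1 + δ)))))

/-- The initial labelling of an expert. -/
def startC (δ : ℕ) : Code :=
  .seq (.loop 14 0 (.put 2 (.reg 14) (.get 1 (.reg 14)))) (guessC δ)

/-- The expert with number `e` (in register `5`) of kind `δ`: four vertices, the digits of `e`, are
labelled in advance in addition to the labels seen so far; the labels are propagated; a vertex without a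
label is predicted to have label `1 + δ`. The prediction is stored in array `5 + δ`, and the weight of
the expert is added to register `12` or to register `13`, according to the prediction. -/
def expertC (δ : ℕ) : Code :=
  .seq (startC δ)
  (.seq propagateC
  (.seq (.put (5 + δ) (.reg 5) (.lit (1 + δ)))
  (.seq (.ite (.get 2 (.reg 1)) (.put (5 + δ) (.reg 5) (.get 2 (.reg 1))) .skip)
  (.ite (.sub (.get (5 + δ) (.reg 5)) (.lit 1))
    (.assign 13 (.add (.reg 13) (.get (3 + δ) (.reg 5))))
    (.assign 12 (.add (.reg 12) (.get (3 + δ) (.reg 5))))))))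

/-- The part of the weight `w` that counts for membership, if the prediction is `k`. -/
def voteIn (k w : ℕ) : ℕ := if k ≤ 1 then w else 0

/-- The part of the weight `w` that counts against membership, if the prediction is `k`. -/
def voteOut (k w : ℕ) : ℕ := if k ≤ 1 then 0 else w

/-- The weighted majority vote of all experts. -/
def predictC : Code :=
  .seq (.assign 12 (.lit 0)) (.seq (.assign 13 (.lit 0))
    (.seq (.loop 5 4 (.seq (expertC 0) (expertC 1)))
      (.assign 2 (.sub (.lit 1) (.sub (.reg 13) (.reg 12))))))

/-- Halve the weight of the expert number `e` (in register `5`) of kind `δ` if it was wrong. -/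
def punishC (δ : ℕ) : Code :=
  .ite (neqE (.get (5 + δ) (.reg 5)) (.sub (.lit 2) (.reg 3)))
    (.put (3 + δ) (.reg 5) (.div (.get (3 + δ) (.reg 5)) (.lit 2))) .skip

/-- Set the listed registers to zero. -/
def clearC : List ℕ → Code
  | [] => .skip
  | x :: l => .seq (.assign x (.lit 0)) (clearC l)

/-- The registers, except `0` and `4`, that are used by the programs. -/
def scratch : List ℕ := [1, 2, 3, 5, 6, 7, 8, 9, 10, 11, 12, 13, 14, 15]

/-- Punish the experts, record the label, and clean up. -/
def updateC : Code :=
  .seq (.loop 5 4 (.seq (punishC 0) (punishC 1)))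
    (.seq (.put 1 (.reg 1) (.sub (.lit 2) (.reg 3))) (clearC scratch))

/-- Give the weight `2 ^ n` to all experts. -/
def initC : Code :=
  .seq (.assign 15 (.lit 1)) (.seq (.loop 14 0 (.assign 15 (.add (.reg 15) (.reg 15))))
    (.seq (.loop 5 4 (.seq (.put 3 (.reg 5) (.reg 15)) (.put 4 (.reg 5) (.reg 15))))
      (clearC scratch)))

/-- The expression for the number of experts of each kind. -/
def expertsE : Expr := .mul (.mul (.mul (.reg 0) (.reg 0)) (.reg 0)) (.reg 0)

/-- The weighted majority learner, with `n ^ 4` experts of each of two kinds `δ = 0, 1`. Array `1` holds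
the labels seen so far, array `2` the labels derived by the expert at work, the arrays `3 + δ` the weights
and the arrays `5 + δ` the predictions of the experts of kind `δ`. -/
def learner : OnlineLearner where
  setup := .seq (.assign 4 expertsE) initC.compile
  predict := predictC.compile
  update := updateC.compile

/-- The labels from which the expert number `e` of kind `δ` starts, if `L` are the labels seen so
far: two of the four vertices get the default label `1 + δ`, the other two get the opposite label. The
default label prevails if the vertices are not distinct. -/
def startLabels (n δ e : ℕ) (L : ℕ → ℕ) : ℕ → ℕ :=
  Function.update (Function.update (Function.update (Function.update L (digit n 2 e) (2 - δ))
    (digit n 3 e) (2 - δ)) (digit n 0 e) (1 + δ)) (digit n 1 e) (1 + δ)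

/-- `k` is a possible prediction for the vertex `v` by the expert number `e` of kind `δ`, if `L` are the
labels seen so far. -/
def Answers {n : ℕ} (G : SimpleGraph (Fin n)) (δ e : ℕ) (L : ℕ → ℕ) (v : Fin n) (k : ℕ) : Prop :=
  ∃ L' : ℕ → ℕ, Stable G L' ∧ (∀ i : Fin n, startLabels n δ e L i ≠ 0 → L' i = startLabels n δ e L i) ∧
    (∀ H, CliqueCut G H → Agrees H (startLabels n δ e L) → Agrees H L') ∧
    k = if L' v = 0 then 1 + δ else L' v

theorem Agrees.congr {n : ℕ} {H : Set (Fin n)} {L L' : ℕ → ℕ} (h : Agrees H L)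
    (he : ∀ i : Fin n, L' i = L i) : Agrees H L' := fun v => by rw [he v]; exact h v

section Runs

variable {n : ℕ} {G : SimpleGraph (Fin n)}

theorem startC_run {s : Memory} (h : Holds G s) (δ : ℕ) {i : ℕ} (hi : i < n) :
    ((startC δ).run s).arr 2 i = startLabels n δ (s.reg 5) (s.arr 1) i := by
  have key := Code.run_loop (x := 14) (y := 0) (s := s) (N := n)
    (P := .put 2 (.reg 14) (.get 1 (.reg 14))) h.reg_zero (by decide)
    (fun i s' => s'.arr 1 = s.arr 1 ∧ ∀ j < i, s'.arr 2 j = s.arr 1 j)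
    ⟨rfl, fun j hj => absurd hj (by omega)⟩ (by
      rintro i - s₀ hx ⟨h1, h2⟩
      refine ⟨by simpa [Code.run, Memory.setReg, Memory.setArr] using h1, fun j hj => ?_⟩
      rcases Nat.lt_succ_iff_lt_or_eq.1 hj with hj | rfl
      · simpa [Code.run, Memory.setReg, Memory.setArr, Expr.eval, hx, hj.ne] using h2 j hj
      · simp [Code.run, Memory.setReg, Memory.setArr, Expr.eval, hx, h1])
  set s₁ := (Code.loop 14 0 (.put 2 (.reg 14) (.get 1 (.reg 14)))).run s
  have r0 : s₁.reg 0 = n := (Code.run_reg _ (by decide) _).trans h.1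
  have r5 : s₁.reg 5 = s.reg 5 := Code.run_reg _ (by decide) _
  have gen : ∀ t : Memory, ((guessC δ).run t).arr 2 =
      startLabels (t.reg 0) δ (t.reg 5) (t.arr 2) := fun t => by
    simp only [guessC, Code.run, startLabels, Memory.setArr, Expr.eval, digitE_eval,
      Function.update_self]
  have : ((startC δ).run s).arr 2 = startLabels n δ (s.reg 5) (s₁.arr 2) := by
    rw [← r0, ← r5, ← gen]; rfl
  rw [this]
  simp only [startLabels, Function.update_apply, key.2 i hi]

/-- The effect of an expert. -/
theorem expertC_run {s : Memory} (h : Holds G s) {δ : ℕ} (hδ : δ = 0 ∨ δ = 1) {v : Fin n}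
    (hv : s.reg 1 = v) :
    ∃ k, Answers G δ (s.reg 5) (s.arr 1) v k ∧
      ((expertC δ).run s).arr (5 + δ) = Function.update (s.arr (5 + δ)) (s.reg 5) k ∧
      ((expertC δ).run s).reg 12 =
        s.reg 12 + voteIn k (s.arr (3 + δ) (s.reg 5)) ∧
      ((expertC δ).run s).reg 13 =
        s.reg 13 + voteOut k (s.arr (3 + δ) (s.reg 5)) := by
  have hn : 0 < n := v.pos
  have hstart : (expertC δ).run s = ((Code.seq (.put (5 + δ) (.reg 5) (.lit (1 + δ)))
      (.seq (.ite (.get 2 (.reg 1)) (.put (5 + δ) (.reg 5) (.get 2 (.reg 1))) .skip)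
      (.ite (.sub (.get (5 + δ) (.reg 5)) (.lit 1))
        (.assign 13 (.add (.reg 13) (.get (3 + δ) (.reg 5))))
        (.assign 12 (.add (.reg 12) (.get (3 + δ) (.reg 5)))))))).run
      (propagateC.run ((startC δ).run s)) := rfl
  have hH : Holds G ((startC δ).run s) := by
    rcases hδ with rfl | rfl <;> exact h.run (by decide) (by decide) (by decide)
  obtain ⟨d, hst⟩ := propagateC_run hH hn
  have hs2 := fun (i : ℕ) (hi : i < n) => startC_run h δ hi
  have r : ∀ x ∈ [1, 5, 12, 13], (propagateC.run ((startC δ).run s)).reg x = s.reg x := by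
    intro x hx
    refine (Code.run_reg _ ?_ _).trans (Code.run_reg _ ?_ _) <;> fin_cases hx <;>
      rcases hδ with rfl | rfl <;> decide
  have ar : ∀ a ∈ [1, 3, 4, 5, 6], (propagateC.run ((startC δ).run s)).arr a = s.arr a := by
    intro x hx
    refine (Code.run_arr _ ?_ _).trans (Code.run_arr _ ?_ _) <;> fin_cases hx <;>
      rcases hδ with rfl | rfl <;> decide
  rw [hstart]
  generalize (propagateC.run ((startC δ).run s)) = s₁ at *
  have r1 := r 1 (by simp)
  have r5 := r 5 (by simp)
  have r12 := r 12 (by simp)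
  have r13 := r 13 (by simp)
  have a5 : s₁.arr (5 + δ) = s.arr (5 + δ) := ar _ (by rcases hδ with rfl | rfl <;> simp)
  have a3 : s₁.arr (3 + δ) = s.arr (3 + δ) := ar _ (by rcases hδ with rfl | rfl <;> simp)
  refine ⟨if s₁.arr 2 v = 0 then 1 + δ else s₁.arr 2 v, ⟨s₁.arr 2, hst, fun i hi => ?_, fun H hH hL => ?_,
    rfl⟩, ?_⟩
  · rw [← hs2 i i.2] at hi ⊢
    exact d.mono i hi
  · exact d.sound H hH (hL.congr fun i => hs2 i i.2)
  -- The rest of the program is straight-line code.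
  have n2 : (2 = 5 + δ) = False := by simp; omega
  have e1 : ∀ k, (Code.ite (.get 2 (.reg 1)) (.put (5 + δ) (.reg 5) (.get 2 (.reg 1))) .skip).run
      (s₁.setArr (5 + δ) (s.reg 5) k) = s₁.setArr (5 + δ) (s.reg 5)
        (if s₁.arr 2 v = 0 then k else s₁.arr 2 v) := fun k => by
    by_cases h0 : s₁.arr 2 v = 0
    · simp [Code.run, Memory.setArr, Expr.eval, r1, hv, n2, h0]
    · simp [Code.run, Memory.setArr, Expr.eval, r1, hv, n2, h0, r5]
  rw [Code.run, Code.run, Code.run, Expr.eval, Expr.eval, r5, e1]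
  generalize (if s₁.arr 2 v = 0 then 1 + δ else s₁.arr 2 v) = k
  by_cases hk : k ≤ 1
  · have hk' : k - 1 = 0 := by omega
    simp [Code.run, Memory.setArr, Memory.setReg, Expr.eval, r5, r12, r13, a5, a3, hk, hk',
      voteIn, voteOut]
  · have hk' : k - 1 ≠ 0 := by omega
    simp [Code.run, Memory.setArr, Memory.setReg, Expr.eval, r5, r12, r13, a5, a3, hk, hk',
      voteIn, voteOut]

/-- The effect of the prediction program. -/
theorem predictC_run {s : Memory} (h : Holds G s) {v : Fin n} (hv : s.reg 1 = v) :
    (∀ e < n ^ 4, Answers G 0 e (s.arr 1) v ((predictC.run s).arr 5 e) ∧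
      Answers G 1 e (s.arr 1) v ((predictC.run s).arr 6 e)) ∧
    ((predictC.run s).reg 2 ≠ 0 ↔
      (∑ e ∈ Finset.range (n ^ 4), (voteOut ((predictC.run s).arr 5 e) (s.arr 3 e) +
        voteOut ((predictC.run s).arr 6 e) (s.arr 4 e))) ≤
      ∑ e ∈ Finset.range (n ^ 4), (voteIn ((predictC.run s).arr 5 e) (s.arr 3 e) +
        voteIn ((predictC.run s).arr 6 e) (s.arr 4 e))) := by
  set s₀ := (s.setReg 12 0).setReg 13 0 with hs₀
  have hH₀ : Holds G s₀ := (h.setReg (by decide) (by decide)).setReg (by decide) (by decide)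
  have key := Code.run_loop (x := 5) (y := 4) (s := s₀) (N := n ^ 4)
    (P := .seq (expertC 0) (expertC 1)) hH₀.reg_four (by decide)
    (fun i s' => Holds G s' ∧ s'.reg 1 = v ∧ s'.arr 1 = s.arr 1 ∧ s'.arr 3 = s.arr 3 ∧
      s'.arr 4 = s.arr 4 ∧
      (∀ e < i, Answers G 0 e (s.arr 1) v (s'.arr 5 e) ∧ Answers G 1 e (s.arr 1) v (s'.arr 6 e)) ∧
      s'.reg 12 = (∑ e ∈ Finset.range i, (voteIn (s'.arr 5 e) (s.arr 3 e) +
        voteIn (s'.arr 6 e) (s.arr 4 e))) ∧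
      s'.reg 13 = ∑ e ∈ Finset.range i, (voteOut (s'.arr 5 e) (s.arr 3 e) +
        voteOut (s'.arr 6 e) (s.arr 4 e)))
    ⟨hH₀.setReg (by decide) (by decide), by simpa [hs₀, Memory.setReg] using hv, rfl, rfl, rfl,
      fun e he => absurd he (by omega), by simp [hs₀, Memory.setReg], by simp [hs₀, Memory.setReg]⟩ ?_
  · obtain ⟨-, -, -, -, -, k1, k2, k3⟩ := key
    have hrun : predictC.run s = ((Code.loop 5 4 (.seq (expertC 0) (expertC 1))).run s₀).setReg 2
        (1 - (((Code.loop 5 4 (.seq (expertC 0) (expertC 1))).run s₀).reg 13 -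
          ((Code.loop 5 4 (.seq (expertC 0) (expertC 1))).run s₀).reg 12)) := rfl
    rw [hrun]
    generalize (Code.loop 5 4 (.seq (expertC 0) (expertC 1))).run s₀ = s₁ at *
    refine ⟨k1, ?_⟩
    simp only [Memory.setReg, Function.update_self]
    rw [← k2, ← k3]
    omega
  · rintro i - s₁ hx ⟨hH₁, q1, b1, b3, b4, hA, q12, q13⟩
    rw [show (Code.seq (expertC 0) (expertC 1)).run s₁ = (expertC 1).run ((expertC 0).run s₁) from rfl]
    obtain ⟨k, hk, e1, e2, e3⟩ := expertC_run hH₁ (δ := 0) (.inl rfl) q1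
    have hH₂ : Holds G ((expertC 0).run s₁) := hH₁.run (by decide) (by decide) (by decide)
    have r1 : ((expertC 0).run s₁).reg 1 = s₁.reg 1 := Code.run_reg _ (by decide) _
    have r5 : ((expertC 0).run s₁).reg 5 = s₁.reg 5 := Code.run_reg _ (by decide) _
    have a1 : ((expertC 0).run s₁).arr 1 = s₁.arr 1 := Code.run_arr _ (by decide) _
    have a3 : ((expertC 0).run s₁).arr 3 = s₁.arr 3 := Code.run_arr _ (by decide) _
    have a4 : ((expertC 0).run s₁).arr 4 = s₁.arr 4 := Code.run_arr _ (by decide) _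
    have a6 : ((expertC 0).run s₁).arr 6 = s₁.arr 6 := Code.run_arr _ (by decide) _
    generalize (expertC 0).run s₁ = s₂ at *
    obtain ⟨l, hl, f1, f2, f3⟩ := expertC_run hH₂ (δ := 1) (.inr rfl) (r1.trans q1)
    have hH₃ : Holds G ((expertC 1).run s₂) := hH₂.run (by decide) (by decide) (by decide)
    have r1' : ((expertC 1).run s₂).reg 1 = s₂.reg 1 := Code.run_reg _ (by decide) _
    have a1' : ((expertC 1).run s₂).arr 1 = s₂.arr 1 := Code.run_arr _ (by decide) _
    have a3' : ((expertC 1).run s₂).arr 3 = s₂.arr 3 := Code.run_arr _ (by decide) _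
    have a4' : ((expertC 1).run s₂).arr 4 = s₂.arr 4 := Code.run_arr _ (by decide) _
    have a5' : ((expertC 1).run s₂).arr 5 = s₂.arr 5 := Code.run_arr _ (by decide) _
    generalize (expertC 1).run s₂ = s₃ at *
    simp only [Nat.add_zero, Nat.reduceAdd] at e1 e2 e3 f1 f2 f3
    rw [hx, b1] at hk
    rw [r5, hx, a1, b1] at hl
    rw [hx] at e1
    rw [r5, hx, a6] at f1
    rw [hx, b3] at e2 e3
    rw [r5, hx, a4, b4, e2] at f2
    rw [r5, hx, a4, b4, e3] at f3
    have v5 : ∀ e, s₃.arr 5 e = if e = i then k else s₁.arr 5 e := fun e => by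
      rw [a5', e1, Function.update_apply]
    have v6 : ∀ e, s₃.arr 6 e = if e = i then l else s₁.arr 6 e := fun e => by
      rw [f1, Function.update_apply]
    refine ⟨hH₃.setReg (by decide) (by decide), ?_, ?_, ?_, ?_, ?_, ?_, ?_⟩
    · simp [Memory.setReg, r1', r1, q1]
    · exact a1'.trans (a1.trans b1)
    · exact a3'.trans (a3.trans b3)
    · exact a4'.trans (a4.trans b4)
    · intro e he
      simp only [Memory.setReg]
      rw [v5, v6]
      by_cases hei : e = i
      · subst hei; simpa using ⟨hk, hl⟩
      · simpa [hei] using hA e (by omega)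
    · simp only [Memory.setReg]
      rw [Function.update_of_ne (by decide), f2, q12, Finset.sum_range_succ, v5, v6, if_pos rfl,
        if_pos rfl, add_assoc]
      congr 1
      refine Finset.sum_congr rfl fun e he => ?_
      rw [Finset.mem_range] at he
      rw [v5, v6, if_neg he.ne, if_neg he.ne]
    · simp only [Memory.setReg]
      rw [Function.update_of_ne (by decide), f3, q13, Finset.sum_range_succ, v5, v6, if_pos rfl,
        if_pos rfl, add_assoc]
      congr 1
      refine Finset.sum_congr rfl fun e he => ?_
      rw [Finset.mem_range] at he
      rw [v5, v6, if_neg he.ne, if_neg he.ne]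

theorem punishC_run (s : Memory) (δ : ℕ) :
    (punishC δ).run s = if s.arr (5 + δ) (s.reg 5) = 2 - s.reg 3 then s
      else s.setArr (3 + δ) (s.reg 5) (s.arr (3 + δ) (s.reg 5) / 2) := by
  have := neqE_eval_eq_zero (e := .get (5 + δ) (.reg 5)) (f := .sub (.lit 2) (.reg 3)) (s := s)
  simp only [Expr.eval] at this
  simp only [punishC, Code.run, Ne, this, ite_not, Expr.eval]

theorem clearC_run (l : List ℕ) (s : Memory) :
    ((clearC l).run s).arr = s.arr ∧
      ∀ x, ((clearC l).run s).reg x = if x ∈ l then 0 else s.reg x := by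
  induction l generalizing s with
  | nil => exact ⟨rfl, fun x => by simp [clearC, Code.run]⟩
  | cons y l ih =>
    obtain ⟨h1, h2⟩ := ih (s.setReg y 0)
    refine ⟨h1, fun x => ?_⟩
    simp only [clearC, Code.run, Expr.eval, h2, List.mem_cons]
    by_cases hx : x ∈ l
    · simp [hx]
    · by_cases hxy : x = y <;> simp [hx, hxy, Memory.setReg]

/-- The effect of the update program. -/
theorem updateC_run {s : Memory} (h : Holds G s) :
    (∀ e < n ^ 4, (updateC.run s).arr 3 e =
      if s.arr 5 e = 2 - s.reg 3 then s.arr 3 e else s.arr 3 e / 2) ∧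
    (∀ e < n ^ 4, (updateC.run s).arr 4 e =
      if s.arr 6 e = 2 - s.reg 3 then s.arr 4 e else s.arr 4 e / 2) ∧
    (updateC.run s).arr 1 = Function.update (s.arr 1) (s.reg 1) (2 - s.reg 3) ∧
    (∀ x, (updateC.run s).reg x = if x ∈ scratch then 0 else s.reg x) := by
  have key := Code.run_loop (x := 5) (y := 4) (s := s) (N := n ^ 4)
    (P := .seq (punishC 0) (punishC 1)) h.reg_four (by decide)
    (fun i s' => (∀ x, x ≠ 5 → s'.reg x = s.reg x) ∧ s'.arr 1 = s.arr 1 ∧ s'.arr 5 = s.arr 5 ∧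
      s'.arr 6 = s.arr 6 ∧
      (∀ e, s'.arr 3 e = if e < i then (if s.arr 5 e = 2 - s.reg 3 then s.arr 3 e else s.arr 3 e / 2)
        else s.arr 3 e) ∧
      ∀ e, s'.arr 4 e = if e < i then (if s.arr 6 e = 2 - s.reg 3 then s.arr 4 e else s.arr 4 e / 2)
        else s.arr 4 e)
    ⟨fun x hx => by simp [Memory.setReg, hx], rfl, rfl, rfl, by simp [Memory.setReg],
      by simp [Memory.setReg]⟩ ?_
  · obtain ⟨k1, k2, -, -, k3, k4⟩ := key
    have hrun : updateC.run s = (clearC scratch).run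
      (((Code.loop 5 4 (.seq (punishC 0) (punishC 1))).run s).setArr 1
        (((Code.loop 5 4 (.seq (punishC 0) (punishC 1))).run s).reg 1)
        (2 - ((Code.loop 5 4 (.seq (punishC 0) (punishC 1))).run s).reg 3)) := rfl
    rw [hrun]
    generalize (Code.loop 5 4 (.seq (punishC 0) (punishC 1))).run s = s₁ at *
    obtain ⟨c1, c2⟩ := clearC_run scratch (s₁.setArr 1 (s₁.reg 1) (2 - s₁.reg 3))
    rw [c1]
    refine ⟨fun e he => ?_, fun e he => ?_, ?_, fun x => ?_⟩
    · simp [Memory.setArr, k3, he]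
    · simp [Memory.setArr, k4, he]
    · simp [Memory.setArr, k1, k2]
    · rw [c2]
      split_ifs with hx
      · rfl
      · exact k1 x (by rintro rfl; exact hx (by decide))
  · rintro i - s₁ hx ⟨q, b1, b5, b6, b3, b4⟩
    have q3 := q 3 (by decide)
    rw [show (Code.seq (punishC 0) (punishC 1)).run s₁ = (punishC 1).run ((punishC 0).run s₁) from rfl]
    have p0 := punishC_run s₁ 0
    have p1 := punishC_run ((punishC 0).run s₁) 1
    have r3 : ((punishC 0).run s₁).reg 3 = s₁.reg 3 := Code.run_reg _ (by decide) _
    have r5 : ((punishC 0).run s₁).reg 5 = s₁.reg 5 := Code.run_reg _ (by decide) _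
    have a4 : ((punishC 0).run s₁).arr 4 = s₁.arr 4 := Code.run_arr _ (by decide) _
    have a6 : ((punishC 0).run s₁).arr 6 = s₁.arr 6 := Code.run_arr _ (by decide) _
    have hreg : ∀ x, ((punishC 1).run ((punishC 0).run s₁)).reg x = s₁.reg x := fun x =>
      (Code.run_reg _ rfl _).trans (Code.run_reg _ rfl _)
    have a1 : ((punishC 1).run ((punishC 0).run s₁)).arr 1 = s₁.arr 1 :=
      (Code.run_arr _ (by decide) _).trans (Code.run_arr _ (by decide) _)
    have a5 : ((punishC 1).run ((punishC 0).run s₁)).arr 5 = s₁.arr 5 :=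
      (Code.run_arr _ (by decide) _).trans (Code.run_arr _ (by decide) _)
    have a6' : ((punishC 1).run ((punishC 0).run s₁)).arr 6 = s₁.arr 6 :=
      (Code.run_arr _ (by decide) _).trans (Code.run_arr _ (by decide) _)
    have a3 : ((punishC 1).run ((punishC 0).run s₁)).arr 3 = ((punishC 0).run s₁).arr 3 :=
      Code.run_arr _ (by decide) _
    refine ⟨fun x hx5 => ?_, a1.trans b1, a5.trans b5, a6'.trans b6, fun e => ?_, fun e => ?_⟩
    · simp [Memory.setReg, hx5, hreg, q x hx5]
    · simp only [Memory.setReg]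
      rw [a3, p0]
      simp only [Nat.add_zero, hx, b5, q3]
      by_cases hei : e = i
      · subst hei
        have := b3 e
        simp only [lt_irrefl, if_false] at this
        rw [if_pos (Nat.lt_succ_self e)]
        split_ifs with hc <;> simp [Memory.setArr, this]
      · have hlt : e < i + 1 ↔ e < i := by omega
        simp only [hlt]
        rw [← b3 e]
        split_ifs <;> simp [Memory.setArr, hei]
    · simp only [Memory.setReg]
      rw [p1, r3, r5, a4, a6]
      simp only [Nat.reduceAdd, hx, b6, q3]
      by_cases hei : e = i
      · subst hei
        have := b4 e
        simp only [lt_irrefl, if_false] at this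
        rw [if_pos (Nat.lt_succ_self e)]
        split_ifs with hc <;> simp [Memory.setArr, this, a4]
      · have hlt : e < i + 1 ↔ e < i := by omega
        simp only [hlt]
        rw [← b4 e]
        split_ifs <;> simp [Memory.setArr, hei, a4]

/-- The effect of the initialization. -/
theorem initC_run {s : Memory} (h : Holds G s) :
    (∀ e < n ^ 4, (initC.run s).arr 3 e = 2 ^ n ∧ (initC.run s).arr 4 e = 2 ^ n) ∧
      (initC.run s).arr 1 = s.arr 1 ∧
      (∀ x, (initC.run s).reg x = if x ∈ scratch then 0 else s.reg x) := by
  set s₀ := s.setReg 15 1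
  have hH₀ : Holds G s₀ := h.setReg (by decide) (by decide)
  have key := Code.run_loop (x := 14) (y := 0) (s := s₀) (N := n)
    (P := .assign 15 (.add (.reg 15) (.reg 15))) hH₀.reg_zero (by decide)
    (fun i s' => s'.reg 15 = 2 ^ i) (by simp [s₀, Memory.setReg]) (by
      intro i _ s' _ hs'
      simp [Code.run, Memory.setReg, Expr.eval, hs', pow_succ]; ring)
  have hrun : initC.run s = (clearC scratch).run
    ((Code.loop 5 4 (.seq (.put 3 (.reg 5) (.reg 15)) (.put 4 (.reg 5) (.reg 15)))).run
      ((Code.loop 14 0 (.assign 15 (.add (.reg 15) (.reg 15)))).run s₀)) := rfl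
  have hH₁ : Holds G ((Code.loop 14 0 (.assign 15 (.add (.reg 15) (.reg 15)))).run s₀) :=
    hH₀.run (by decide) (by decide) (by decide)
  have ar : ((Code.loop 14 0 (.assign 15 (.add (.reg 15) (.reg 15)))).run s₀).arr 1 = s.arr 1 :=
    Code.run_arr _ (by decide) _
  have rr : ∀ x, x ∉ scratch → ((Code.loop 14 0 (.assign 15 (.add (.reg 15) (.reg 15)))).run s₀).reg x =
      s.reg x := fun x hx => by
    have h15 : x ≠ 15 := by rintro rfl; exact hx (by decide)
    have h14 : x ≠ 14 := by rintro rfl; exact hx (by decide)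
    refine (Code.run_reg _ (by simp [Code.writesReg, h15, h14]) _).trans ?_
    simp [s₀, Memory.setReg, h15]
  rw [hrun]
  generalize (Code.loop 14 0 (.assign 15 (.add (.reg 15) (.reg 15)))).run s₀ = s₁ at *
  have key₂ := Code.run_loop (x := 5) (y := 4) (s := s₁) (N := n ^ 4)
    (P := .seq (.put 3 (.reg 5) (.reg 15)) (.put 4 (.reg 5) (.reg 15))) hH₁.reg_four (by decide)
    (fun i s' => s'.reg 15 = 2 ^ n ∧ ∀ e < i, s'.arr 3 e = 2 ^ n ∧ s'.arr 4 e = 2 ^ n)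
    ⟨by simpa [Memory.setReg] using key, fun e he => absurd he (by omega)⟩ (by
      rintro i - s' hx ⟨h15, hs'⟩
      refine ⟨by simpa [Code.run, Memory.setReg, Memory.setArr] using h15, fun e he => ?_⟩
      by_cases hei : e = i
      · simp [Code.run, Memory.setReg, Memory.setArr, Expr.eval, hx, h15, hei]
      · have := hs' e (by omega)
        simpa [Code.run, Memory.setReg, Memory.setArr, Expr.eval, hx, hei] using this)
  have ar₂ : ((Code.loop 5 4 (.seq (.put 3 (.reg 5) (.reg 15)) (.put 4 (.reg 5) (.reg 15)))).run s₁).arr 1 =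
    s₁.arr 1 := Code.run_arr _ (by decide) _
  have rr₂ : ∀ x, x ∉ scratch →
      ((Code.loop 5 4 (.seq (.put 3 (.reg 5) (.reg 15)) (.put 4 (.reg 5) (.reg 15)))).run s₁).reg x =
      s₁.reg x := fun x hx => by
    have h5 : x ≠ 5 := by rintro rfl; exact hx (by decide)
    exact Code.run_reg _ (by simp [Code.writesReg, h5]) _
  generalize (Code.loop 5 4 (.seq (.put 3 (.reg 5) (.reg 15)) (.put 4 (.reg 5) (.reg 15)))).run s₁ = s₂ at *
  obtain ⟨c1, c2⟩ := clearC_run scratch s₂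
  rw [c1]
  refine ⟨key₂.2, ar₂.trans ar, fun x => ?_⟩
  rw [c2]
  split_ifs with hx
  · rfl
  · exact (rr₂ x hx).trans (rr x hx)

end Runs

/-! ### The good expert -/

section Expert

variable {n : ℕ} {G : SimpleGraph (Fin n)}

/-- The prediction `k` is right for the vertex `v`. -/
def IsLabel (H : Set (Fin n)) (v : Fin n) (k : ℕ) : Prop := v ∈ H ∧ k = 1 ∨ v ∉ H ∧ k = 2

/-- The four vertices of the expert number `e` have labels. -/
def Covers (n e : ℕ) (L : ℕ → ℕ) : Prop := ∀ k < 4, L (digit n k e) ≠ 0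

/-- An expert that makes at most `d` mistakes when the target is `H`: its own labels are right, and the
vertices on which it is wrong have to be taken from different classes of the relation `R`, of which there
are at most `d`. -/
structure GoodExpert (G : SimpleGraph (Fin n)) (H : Set (Fin n)) (d δ e : ℕ)
    (R : Fin n → Fin n → Prop) : Prop where
  lt : e < n ^ 4
  kind : δ = 0 ∨ δ = 1
  symm : ∀ v w, R v w → R w v
  agrees : ∀ L, Agrees H L → Agrees H (startLabels n δ e L)
  spreads : ∀ L, Agrees H L → Stable G L → Covers n e L → ∀ v w, R v w → L v ≠ 0 → L w ≠ 0
  card_le : ∀ M : Finset (Fin n), (∀ v ∈ M, ¬ IsLabel H v (1 + δ) ∧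
    ∃ L, Agrees H L ∧ Stable G L ∧ Covers n e L ∧ L v = 0) →
    (∀ v ∈ M, ∀ w ∈ M, R v w → v = w) → M.card ≤ d

theorem startLabels_ne_zero {δ e : ℕ} (hδ : δ = 0 ∨ δ = 1) {L : ℕ → ℕ} {i : ℕ} (hi : L i ≠ 0) :
    startLabels n δ e L i ≠ 0 := by
  simp only [startLabels, Function.update_apply]
  split_ifs <;> omega

theorem covers_startLabels {δ e : ℕ} (hδ : δ = 0 ∨ δ = 1) (L : ℕ → ℕ) :
    Covers n e (startLabels n δ e L) := by
  intro k hk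
  interval_cases k <;> simp only [startLabels, Function.update_apply] <;> split_ifs <;> omega

theorem exists_goodExpert (hG : G.Connected) {H : Set (Fin n)} (hH : CliqueCut G H) :
    ∃ δ e R, GoodExpert G H (mHalfspaces G).vcDim δ e R := by
  obtain ⟨v⟩ := hG.nonempty
  -- For the trivial halfspaces, the default prediction is always right. With four equal vertices, only
  -- the default label is assumed in advance.
  have trivial_case : ∀ δ, (δ = 0 ∨ δ = 1) → (∀ v, IsLabel H v (1 + δ)) →
      ∃ δ e R, GoodExpert G H (mHalfspaces G).vcDim δ e R := by
    intro δ hδ hH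
    obtain ⟨e, he, e0, e1, e2, e3⟩ := exists_digits v.2 v.2 v.2 v.2
    refine ⟨δ, e, fun _ _ => False, he, hδ, fun _ _ h => h, fun L hL => ?_, fun _ _ _ _ _ _ h => h.elim,
      fun M hM _ => ?_⟩
    · simp only [startLabels, e0, e1, e2, e3, Function.update_idem]
      exact hL.update (hH v)
    · rw [Finset.eq_empty_of_forall_notMem fun v hv => (hM v hv).1 (hH v)]
      simp
  by_cases hx : ∃ x, x ∈ H
  swap
  · exact trivial_case 1 (.inr rfl) fun v => .inr ⟨fun h => hx ⟨v, h⟩, rfl⟩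
  by_cases hy : ∃ y, y ∉ H
  swap
  · exact trivial_case 0 (.inl rfl) fun v => .inl ⟨not_not.1 fun h => hy ⟨v, h⟩, rfl⟩
  obtain ⟨x, hx⟩ := hx
  obtain ⟨y, hy⟩ := hy
  obtain ⟨a, ha, c₁, hc₁, b, hb, c₂, hc₂, R, hsymm, hspread, hcard⟩ := exists_good_vertices hG hH hx hy
  obtain ⟨e, he, e0, e1, e2, e3⟩ := exists_digits b.2 c₂.2 a.2 c₁.2
  have cov : ∀ L, Covers n e L → L b ≠ 0 ∧ L c₂ ≠ 0 ∧ L a ≠ 0 ∧ L c₁ ≠ 0 := fun L hL => by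
    rw [← e0, ← e1, ← e2, ← e3]
    exact ⟨hL 0 (by norm_num), hL 1 (by norm_num), hL 2 (by norm_num), hL 3 (by norm_num)⟩
  refine ⟨1, e, R, he, .inr rfl, hsymm, fun L hL => ?_, fun L hL hS hC v w hvw hv => ?_,
    fun M hM hMR => hcard M (fun v hv => ?_) hMR⟩
  · simp only [startLabels, e0, e1, e2, e3]
    exact (((hL.update (.inl ⟨ha, rfl⟩)).update (.inl ⟨hc₁, rfl⟩)).update
      (.inr ⟨hb, rfl⟩)).update (.inr ⟨hc₂, rfl⟩)
  · obtain ⟨k1, -, k3, -⟩ := cov L hC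
    exact hspread _ (hS.propClosed hL) k3 k1 v w hvw hv
  · obtain ⟨hdef, L, hL, hS, hC, hLv⟩ := hM v hv
    obtain ⟨k1, k2, k3, k4⟩ := cov L hC
    refine ⟨?_, _, hS.propClosed hL, k3, k4, k1, k2, fun h => h hLv⟩
    by_contra hvH
    exact hdef (.inr ⟨hvH, rfl⟩)

end Expert

/-! ### A round of the learner -/

section Round

variable {n : ℕ} {G : SimpleGraph (Fin n)}

theorem propagateC_tame : propagateC.Tame := by
  simp [propagateC, sweepC, decodeC, inferC, firesE, neqE, minE, adjE, digitE, shiftE, Code.Tame,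
    Code.writesReg, Expr.Linear]

theorem expertC_tame (δ : ℕ) : (expertC δ).Tame := by
  refine ⟨?_, propagateC_tame, ?_⟩ <;>
  simp [startC, guessC, digitE, shiftE, Code.Tame, Code.writesReg, Expr.Linear]

theorem predictC_tame : predictC.Tame := by
  refine ⟨by simp [Code.Tame, Expr.Linear], by simp [Code.Tame, Expr.Linear],
    ⟨by simp, by simp, by simp, by decide, expertC_tame 0, expertC_tame 1⟩,
    by simp [Code.Tame, Expr.Linear]⟩

theorem clearC_scratch_tame : (clearC scratch).Tame := by
  simp [clearC, scratch, Code.Tame, Expr.Linear]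

theorem updateC_tame : updateC.Tame := by
  refine ⟨?_, ?_, clearC_scratch_tame⟩ <;>
  simp [punishC, neqE, Code.Tame, Code.writesReg, Expr.Linear]

theorem initC_tame : initC.Tame := by
  refine ⟨?_, ?_, ?_, clearC_scratch_tame⟩ <;> simp [Code.Tame, Code.writesReg, Expr.Linear]

theorem clearC_allPuts (Q : ℕ → Expr → Expr → Prop) (l : List ℕ) : (clearC l).AllPuts Q := by
  induction l with
  | nil => trivial
  | cons x l ih => exact ⟨trivial, ih⟩

theorem expertC_small {b δ : ℕ} (hb : 2 < b) (hδ : δ ≤ 1) : (expertC δ).AllPuts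
    fun _ _ e => ∀ s : Memory, (∀ a i, s.arr a i < b) → e.eval s < b := by
  have lit : ∀ k ≤ 2, ∀ s : Memory, (∀ a i, s.arr a i < b) → (Expr.lit k).eval s < b :=
    fun k hk s _ => hk.trans_lt hb
  have get : ∀ a (i : Expr), ∀ s : Memory, (∀ a i, s.arr a i < b) → (Expr.get a i).eval s < b :=
    fun a i s hs => hs _ _
  exact ⟨⟨get _ _, lit _ (by omega), lit _ (by omega), lit _ (by omega), lit _ (by omega)⟩,
    ⟨⟨trivial, trivial, trivial, trivial⟩,
      ⟨trivial, ⟨trivial, lit _ (by omega)⟩, ⟨trivial, lit _ (by omega)⟩⟩,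
      ⟨trivial, ⟨trivial, lit _ (by omega)⟩, ⟨trivial, lit _ (by omega)⟩⟩⟩,
    lit _ (by omega), ⟨get _ _, trivial⟩, trivial, trivial⟩

theorem predictC_small {b : ℕ} (hb : 2 < b) {s : Memory} (hs : ∀ a i, s.arr a i < b) :
    ∀ a i, (predictC.run s).arr a i < b :=
  Code.AllPuts.run (J := (· < b)) (P := predictC) ⟨trivial, trivial,
    ⟨expertC_small hb zero_le_one, expertC_small hb le_rfl⟩, trivial⟩ hs

theorem updateC_small {b : ℕ} (hb : 2 < b) {s : Memory} (hs : ∀ a i, s.arr a i < b) :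
    ∀ a i, (updateC.run s).arr a i < b := by
  refine Code.AllPuts.run (J := (· < b)) (P := updateC) ⟨⟨⟨?_, trivial⟩, ⟨?_, trivial⟩⟩, ?_,
    clearC_allPuts _ _⟩ hs
  · exact fun s hs => (Nat.div_le_self _ _).trans_lt (hs _ _)
  · exact fun s hs => (Nat.div_le_self _ _).trans_lt (hs _ _)
  · exact fun s _ => (Nat.sub_le _ _).trans_lt hb

/-- What holds between two rounds: after `k` mistakes, the total weight of the experts has dropped by the
factor `(3 / 4) ^ k`, while the weight of the good expert has been halved at most once for each element of
a set `M` of vertices that witnesses its mistakes. -/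
structure Invariant (G : SimpleGraph (Fin n)) (H : Set (Fin n)) (δ e : ℕ)
    (R : Fin n → Fin n → Prop) (b k : ℕ) (s : Memory) : Prop where
  holds : Holds G s
  clean : ∀ x, x ≠ 0 → x ≠ 4 → s.reg x = 0
  bounded : s.Bounded b
  agrees : Agrees H (s.arr 1)
  potential : 4 ^ k * ∑ i ∈ Finset.range (n ^ 4), (s.arr 3 i + s.arr 4 i) ≤
    3 ^ k * (n ^ 4 * (2 ^ n + 2 ^ n))
  mistakes : ∃ M : Finset (Fin n), (∀ v ∈ M, s.arr 1 v ≠ 0) ∧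
    (∀ v ∈ M, ¬ IsLabel H v (1 + δ) ∧ ∃ L, Agrees H L ∧ Stable G L ∧ Covers n e L ∧ L v = 0) ∧
    (∀ v ∈ M, ∀ w ∈ M, R v w → v = w) ∧ s.arr (3 + δ) e = 2 ^ (n - M.card)

/-- If `t` is the right label, the weight that remains after punishing wrong predictions. -/
def reweigh (t k w : ℕ) : ℕ := if k = t then w else w / 2

theorem voteIn_add_voteOut (k w : ℕ) : voteIn k w + voteOut k w = w := by
  simp only [voteIn, voteOut]; split_ifs <;> omega

theorem reweigh_le (t k w : ℕ) : reweigh t k w ≤ w := by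
  simp only [reweigh]; split_ifs <;> omega

theorem two_mul_reweigh_one_le (k w : ℕ) : 2 * reweigh 1 k w ≤ 2 * voteIn k w + voteOut k w := by
  simp only [reweigh, voteIn, voteOut]; split_ifs <;> omega

theorem two_mul_reweigh_two_le (k w : ℕ) : 2 * reweigh 2 k w ≤ 2 * voteOut k w + voteIn k w := by
  simp only [reweigh, voteIn, voteOut]; split_ifs <;> omega

/-- A wrong answer by an expert means that it has no label for the vertex and that its default is
wrong. -/
theorem Answers.of_wrong {H : Set (Fin n)} (hH : CliqueCut G H) {d δ e : ℕ}
    {R : Fin n → Fin n → Prop} (hE : GoodExpert G H d δ e R) {L : ℕ → ℕ} (hL : Agrees H L) {v : Fin n}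
    {k : ℕ} (hA : Answers G δ e L v k) (hk : ¬ IsLabel H v k) :
    ¬ IsLabel H v (1 + δ) ∧ ∃ L', Agrees H L' ∧ Stable G L' ∧ Covers n e L' ∧ L' v = 0 ∧
      ∀ w : Fin n, L w ≠ 0 → L' w ≠ 0 := by
  obtain ⟨L', hS, hmono, hsound, rfl⟩ := hA
  have hL' := hsound H hH (hE.agrees L hL)
  by_cases h0 : L' v = 0
  · rw [if_pos h0] at hk
    refine ⟨hk, L', hL', hS, fun j hj => ?_, h0, fun w hw => ?_⟩
    · have h := covers_startLabels (n := n) (e := e) hE.kind L j hj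
      rwa [← hmono ⟨digit n j e, digit_lt v.pos⟩ h] at h
    · have h := startLabels_ne_zero (n := n) (e := e) hE.kind hw
      rwa [← hmono w h] at h
  · rw [if_neg h0] at hk
    exact absurd ((hL' v).resolve_left h0) hk

/-- Every round preserves the invariant. -/
theorem Invariant.round {H : Finset (Fin n)} (hH : CliqueCut G (H : Set (Fin n))) {d δ e : ℕ}
    {R : Fin n → Fin n → Prop} (hE : GoodExpert G (H : Set (Fin n)) d δ e R) {b k : ℕ} (hb : 2 ≤ b)
    {s : Memory} (hs : Invariant G (H : Set (Fin n)) δ e R b k s) (v : Fin n) :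
    Invariant G (H : Set (Fin n)) δ e R b
      (k + if ((predictC.run (s.setReg 1 v)).reg 2 ≠ 0 ↔ v ∈ H) then 0 else 1)
      (updateC.run ((predictC.run (s.setReg 1 v)).setReg 3 (label H v))) := by
  have h0 : Holds G (s.setReg 1 v) := hs.holds.setReg (by decide) (by decide)
  obtain ⟨hans, hvote⟩ := predictC_run h0 (v := v) (by simp [Memory.setReg])
  have h1 : Holds G (predictC.run (s.setReg 1 v)) := h0.run (by decide) (by decide) (by decide)
  have a1 : (predictC.run (s.setReg 1 v)).arr 1 = s.arr 1 := Code.run_arr _ (by decide) _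
  have a3 : (predictC.run (s.setReg 1 v)).arr 3 = s.arr 3 := Code.run_arr _ (by decide) _
  have a4 : (predictC.run (s.setReg 1 v)).arr 4 = s.arr 4 := Code.run_arr _ (by decide) _
  have r1 : (predictC.run (s.setReg 1 v)).reg 1 = v :=
    (Code.run_reg _ (by decide) _).trans (by simp [Memory.setReg])
  have rx : ∀ x, x ∉ scratch → (predictC.run (s.setReg 1 v)).reg x = s.reg x := fun x hx => by
    have hx' : ∀ y ∈ scratch, x ≠ y := fun y hy h => hx (h ▸ hy)
    refine (Code.run_reg _ ?_ _).trans ?_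
    · simp only [scratch, List.mem_cons, List.not_mem_nil, or_false, forall_eq_or_imp, forall_eq] at hx'
      simp [predictC, expertC, startC, guessC, propagateC, sweepC, decodeC, inferC, Code.writesReg, hx']
    · simp [Memory.setReg, hx' 1 (by decide)]
  have hpow : 2 < 2 ^ b := lt_of_lt_of_le (by norm_num) (Nat.pow_le_pow_right two_pos hb)
  have small := predictC_small (s := s.setReg 1 v) hpow hs.bounded.2
  have hans' : ∀ i < n ^ 4, Answers G 0 i (s.arr 1) v ((predictC.run (s.setReg 1 v)).arr 5 i) ∧
      Answers G 1 i (s.arr 1) v ((predictC.run (s.setReg 1 v)).arr 6 i) := hans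
  have hvote' : (predictC.run (s.setReg 1 v)).reg 2 ≠ 0 ↔
      (∑ e ∈ Finset.range (n ^ 4), (voteOut ((predictC.run (s.setReg 1 v)).arr 5 e) (s.arr 3 e) +
        voteOut ((predictC.run (s.setReg 1 v)).arr 6 e) (s.arr 4 e))) ≤
      ∑ e ∈ Finset.range (n ^ 4), (voteIn ((predictC.run (s.setReg 1 v)).arr 5 e) (s.arr 3 e) +
        voteIn ((predictC.run (s.setReg 1 v)).arr 6 e) (s.arr 4 e)) := hvote
  clear hans hvote
  generalize predictC.run (s.setReg 1 v) = s₁ at *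
  set s₂ := s₁.setReg 3 (label H v) with hs₂
  have h2 : Holds G s₂ := h1.setReg (by decide) (by decide)
  obtain ⟨u3, u4, u1, ur⟩ := updateC_run h2
  have h3 : Holds G (updateC.run s₂) := h2.run (by decide) (by decide) (by decide)
  have small' := updateC_small (s := s₂) hpow small
  generalize updateC.run s₂ = s₃ at *
  obtain ⟨t, ht, htL⟩ : ∃ t, 2 - label H v = t ∧ (v ∈ H ∧ t = 1 ∨ v ∉ H ∧ t = 2) := by
    refine ⟨_, rfl, ?_⟩
    by_cases hv : v ∈ H <;> simp [label, hv]
  have e5 : s₂.arr 5 = s₁.arr 5 := rfl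
  have e6 : s₂.arr 6 = s₁.arr 6 := rfl
  have e1 : s₂.arr 1 = s.arr 1 := a1
  have e3 : s₂.arr 3 = s.arr 3 := a3
  have e4 : s₂.arr 4 = s.arr 4 := a4
  have er3 : s₂.reg 3 = label H v := by simp [hs₂, Memory.setReg]
  have er1 : s₂.reg 1 = v := by simp [hs₂, Memory.setReg, r1]
  rw [er3, ht, e5, e3] at u3
  rw [er3, ht, e6, e4] at u4
  rw [er3, ht, er1, e1] at u1
  have hclean : ∀ x, x ≠ 0 → x ≠ 4 → s₃.reg x = 0 := fun x hx0 hx4 => by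
    rw [ur]
    split_ifs with hx
    · rfl
    · have : x ≠ 3 := by rintro rfl; exact hx (by decide)
      simp only [hs₂, Memory.setReg, Function.update_of_ne this]
      rw [rx x hx, hs.clean x hx0 hx4]
  refine ⟨h3, hclean, ⟨fun x => ?_, small'⟩, ?_, ?_, ?_⟩
  · by_cases hx0 : x = 0
    · subst hx0; rw [h3.1, ← hs.holds.1]; exact hs.bounded.1 0
    by_cases hx4 : x = 4
    · subst hx4; rw [h3.2, ← hs.holds.2]; exact hs.bounded.1 4
    rw [hclean x hx0 hx4]; positivity
  · rw [u1]; exact hs.agrees.update (by simpa using htL)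
  · -- A mistake of the learner is a mistake of experts with at least half of the total weight.
    have hnew : ∑ i ∈ Finset.range (n ^ 4), (s₃.arr 3 i + s₃.arr 4 i) = ∑ i ∈ Finset.range (n ^ 4),
        (reweigh t (s₁.arr 5 i) (s.arr 3 i) + reweigh t (s₁.arr 6 i) (s.arr 4 i)) :=
      Finset.sum_congr rfl fun i hi => by
        rw [Finset.mem_range] at hi
        rw [u3 i hi, u4 i hi, reweigh, reweigh]
    have hold : ∑ i ∈ Finset.range (n ^ 4), (s.arr 3 i + s.arr 4 i) =
        ∑ e ∈ Finset.range (n ^ 4), (voteIn (s₁.arr 5 e) (s.arr 3 e) + voteIn (s₁.arr 6 e) (s.arr 4 e)) +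
        ∑ e ∈ Finset.range (n ^ 4),
          (voteOut (s₁.arr 5 e) (s.arr 3 e) + voteOut (s₁.arr 6 e) (s.arr 4 e)) := by
      rw [← Finset.sum_add_distrib]
      refine Finset.sum_congr rfl fun i _ => ?_
      have := voteIn_add_voteOut (s₁.arr 5 i) (s.arr 3 i)
      have := voteIn_add_voteOut (s₁.arr 6 i) (s.arr 4 i)
      omega
    have hpot := hs.potential
    split_ifs with hcorrect
    · rw [add_zero]
      refine le_trans (Nat.mul_le_mul_left _ ?_) hpot
      rw [hnew]
      exact Finset.sum_le_sum fun i _ => add_le_add (reweigh_le _ _ _) (reweigh_le _ _ _)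
    · suffices h : 4 * ∑ i ∈ Finset.range (n ^ 4), (s₃.arr 3 i + s₃.arr 4 i) ≤
          3 * ∑ i ∈ Finset.range (n ^ 4), (s.arr 3 i + s.arr 4 i) by
        calc _ = 4 ^ k * (4 * ∑ i ∈ Finset.range (n ^ 4), (s₃.arr 3 i + s₃.arr 4 i)) := by ring
          _ ≤ 4 ^ k * (3 * ∑ i ∈ Finset.range (n ^ 4), (s.arr 3 i + s.arr 4 i)) :=
            Nat.mul_le_mul_left _ h
          _ = 3 * (4 ^ k * ∑ i ∈ Finset.range (n ^ 4), (s.arr 3 i + s.arr 4 i)) := by ring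
          _ ≤ 3 * (3 ^ k * (n ^ 4 * (2 ^ n + 2 ^ n))) := Nat.mul_le_mul_left _ hpot
          _ = _ := by ring
      rw [hnew, hold]
      rcases htL with ⟨hv, rfl⟩ | ⟨hv, rfl⟩
      · have hlt := mt hvote'.2 (by tauto)
        have : 2 * ∑ i ∈ Finset.range (n ^ 4),
            (reweigh 1 (s₁.arr 5 i) (s.arr 3 i) + reweigh 1 (s₁.arr 6 i) (s.arr 4 i)) ≤
            2 * ∑ e ∈ Finset.range (n ^ 4),
              (voteIn (s₁.arr 5 e) (s.arr 3 e) + voteIn (s₁.arr 6 e) (s.arr 4 e)) +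
            ∑ e ∈ Finset.range (n ^ 4),
              (voteOut (s₁.arr 5 e) (s.arr 3 e) + voteOut (s₁.arr 6 e) (s.arr 4 e)) := by
          rw [Finset.mul_sum, Finset.mul_sum, ← Finset.sum_add_distrib]
          refine Finset.sum_le_sum fun i _ => ?_
          have := two_mul_reweigh_one_le (s₁.arr 5 i) (s.arr 3 i)
          have := two_mul_reweigh_one_le (s₁.arr 6 i) (s.arr 4 i)
          omega
        omega
      · have hle := hvote'.1 (by tauto)
        have : 2 * ∑ i ∈ Finset.range (n ^ 4),
            (reweigh 2 (s₁.arr 5 i) (s.arr 3 i) + reweigh 2 (s₁.arr 6 i) (s.arr 4 i)) ≤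
            2 * ∑ e ∈ Finset.range (n ^ 4),
              (voteOut (s₁.arr 5 e) (s.arr 3 e) + voteOut (s₁.arr 6 e) (s.arr 4 e)) +
            ∑ e ∈ Finset.range (n ^ 4),
              (voteIn (s₁.arr 5 e) (s.arr 3 e) + voteIn (s₁.arr 6 e) (s.arr 4 e)) := by
          rw [Finset.mul_sum, Finset.mul_sum, ← Finset.sum_add_distrib]
          refine Finset.sum_le_sum fun i _ => ?_
          have := two_mul_reweigh_two_le (s₁.arr 5 i) (s.arr 3 i)
          have := two_mul_reweigh_two_le (s₁.arr 6 i) (s.arr 4 i)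
          omega
        omega
  · obtain ⟨M, hM1, hM2, hM3, hM4⟩ := hs.mistakes
    obtain ⟨q, hq, hw⟩ : ∃ q, Answers G δ e (s.arr 1) v q ∧
        s₃.arr (3 + δ) e = if q = t then s.arr (3 + δ) e else s.arr (3 + δ) e / 2 := by
      rcases hE.kind with rfl | rfl
      · exact ⟨_, (hans' e hE.lt).1, u3 e hE.lt⟩
      · exact ⟨_, (hans' e hE.lt).2, u4 e hE.lt⟩
    have known : ∀ w : Fin n, s.arr 1 w ≠ 0 ∨ w = v → s₃.arr 1 w ≠ 0 := fun w hw => by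
      rw [u1, Function.update_apply]
      split_ifs with hc
      · omega
      · exact hw.resolve_right fun h => hc (congrArg _ h)
    by_cases hqt : q = t
    · rw [if_pos hqt] at hw
      exact ⟨M, fun w hwM => known w (.inl (hM1 w hwM)), hM2, hM3, hw.trans hM4⟩
    · rw [if_neg hqt] at hw
      obtain ⟨k1, L, k2, k3, k4, k5, k6⟩ := hq.of_wrong hH hE hs.agrees (v := v) (by
        rintro (h | h) <;> rcases htL with h' | h'
        · exact hqt (h.2.trans h'.2.symm)
        · exact h'.1 h.1
        · exact h.1 h'.1
        · exact hqt (h.2.trans h'.2.symm))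
      -- The new mistake is not related to the earlier ones, whose classes are labelled already.
      have hR : ∀ w ∈ M, ¬ R w v := fun w hwM hwv =>
        hE.spreads L k2 k3 k4 w v hwv (k6 w (hM1 w hwM)) k5
      have hvM : v ∉ M := fun hvM => k6 v (hM1 v hvM) k5
      refine ⟨insert v M, ?_, ?_, ?_, ?_⟩
      · intro w hwM
        rcases Finset.mem_insert.1 hwM with rfl | hwM
        exacts [known w (.inr rfl), known w (.inl (hM1 w hwM))]
      · intro w hwM
        rcases Finset.mem_insert.1 hwM with rfl | hwM
        exacts [⟨k1, L, k2, k3, k4, k5⟩, hM2 w hwM]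
      · intro x hx y hy hxy
        rcases Finset.mem_insert.1 hx with hxv | hxM <;>
          rcases Finset.mem_insert.1 hy with hyv | hyM
        · exact hxv.trans hyv.symm
        · exact absurd (hE.symm _ _ (hxv ▸ hxy)) (hR y hyM)
        · exact absurd (hyv ▸ hxy) (hR x hxM)
        · exact hM3 x hxM y hyM hxy
      · have hcard : (insert v M).card ≤ n := by
          simpa using Finset.card_le_univ (insert v M)
        rw [Finset.card_insert_of_notMem hvM] at hcard ⊢
        rw [hw, hM4, show n - M.card = (n - (M.card + 1)) + 1 by omega, pow_succ,
          Nat.mul_div_cancel _ two_pos]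

end Round

/-! ### Mistake bound and running time -/

section Final

/-- The mistake bound for weighted majority, from the final weights. -/
theorem mistakes_le {n k m d : ℕ} (hn : 0 < n) (hm : m ≤ d) (hd : 1 ≤ d) (hmn : m ≤ n)
    (h : 4 ^ k * 2 ^ (n - m) ≤ 3 ^ k * (n ^ 4 * (2 ^ n + 2 ^ n))) :
    (k : ℝ) ≤ 16 * (d + Real.log n) := by
  have h1 : (4 : ℝ) ^ k * 2 ^ (n - m) ≤ 3 ^ k * ((n : ℝ) ^ 4 * (2 ^ n + 2 ^ n)) := by exact_mod_cast h
  have h2 : (2 : ℝ) ^ n = 2 ^ (n - m) * 2 ^ m := by rw [← pow_add]; congr 1; omega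
  have h3 : (4 : ℝ) ^ k ≤ 3 ^ k * ((n : ℝ) ^ 4 * 2 ^ (m + 1)) := by
    have hpos : (0 : ℝ) < 2 ^ (n - m) := by positivity
    refine le_of_mul_le_mul_right ?_ hpos
    calc _ ≤ _ := h1
      _ = _ := by rw [h2]; ring
  have hn' : (0 : ℝ) < n := by exact_mod_cast hn
  have h4 := Real.log_le_log (by positivity) h3
  rw [Real.log_mul (by positivity) (by positivity), Real.log_mul (by positivity) (by positivity),
    Real.log_pow, Real.log_pow, Real.log_pow, Real.log_pow] at h4
  have h5 : (1 : ℝ) / 4 ≤ Real.log 4 - Real.log 3 := by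
    rw [← Real.log_div (by norm_num) (by norm_num)]
    have := Real.one_sub_inv_le_log_of_pos (show (0 : ℝ) < 4 / 3 by norm_num)
    norm_num at this ⊢
    linarith
  have h6 : Real.log 2 ≤ 1 := by have := Real.log_two_lt_d9; linarith
  have h7 : (0 : ℝ) ≤ Real.log 2 := Real.log_nonneg (by norm_num)
  have h8 : (0 : ℝ) ≤ Real.log n := Real.log_natCast_nonneg n
  have h9 : ((m + 1 : ℕ) : ℝ) ≤ 2 * d := by
    have : m + 1 ≤ 2 * d := by omega
    exact_mod_cast this
  have h10 : ((m + 1 : ℕ) : ℝ) * Real.log 2 ≤ 2 * d := by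
    have : (0 : ℝ) ≤ (m + 1 : ℕ) := by positivity
    nlinarith
  have hk : (0 : ℝ) ≤ k := by positivity
  have h11 : (k : ℝ) * (1 / 4) ≤ k * (Real.log 4 - Real.log 3) := mul_le_mul_of_nonneg_left h5 hk
  have hd' : (0 : ℝ) ≤ d := by positivity
  push_cast at h4 h10
  nlinarith

theorem inputMemory_bounded {n : ℕ} (G : SimpleGraph (Fin n)) : (inputMemory G).Bounded (n + 1) := by
  have h1 : (1 : ℕ) < 2 ^ (n + 1) := Nat.one_lt_two_pow (by omega)
  have h2 : n < 2 ^ (n + 1) := Nat.lt_two_pow_self.trans (Nat.pow_lt_pow_right (by norm_num) (by omega))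
  constructor
  · intro x
    simp only [inputMemory, Function.update_apply]
    split_ifs <;> omega
  · intro a i
    simp only [inputMemory, Function.update_apply]
    split_ifs
    · dsimp only
      split_ifs <;> omega
    · positivity

theorem OnlineLearner.Run.mono {A : OnlineLearner} {n : ℕ} {G : SimpleGraph (Fin n)}
    {H : Finset (Fin n)} {τ τ' : ℕ} (hτ : τ ≤ τ') {vs : List (Fin n)} {s : Memory} {k : ℕ}
    (h : A.Run G H τ vs s k) : A.Run G H τ' vs s k := by
  induction h with
  | start h1 h2 => exact .start h1 (h2.trans hτ)
  | round v _ h1 h2 h3 ih => exact .round v ih h1 h2 (h3.trans hτ)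

/-- The learner runs in polynomial time and makes `O(d + log n)` mistakes. -/
theorem learner_learnsHalfspaces : ∃ p : Polynomial ℕ, ∀ (n : ℕ) (G : SimpleGraph (Fin n)),
    G.Connected → learner.LearnsHalfspaces G (p.eval n)
      (16 * ((mHalfspaces G).vcDim + Real.log n)) := by
  obtain ⟨pE, hpE⟩ := expertsE.exists_weight_le
  obtain ⟨pI, hpI⟩ := initC.exists_steps_le
  obtain ⟨pP, hpP⟩ := predictC.exists_steps_le
  obtain ⟨pU, hpU⟩ := updateC.exists_steps_le
  -- `q` bounds the bit lengths of all numbers and the number of steps.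
  set q : Polynomial ℕ := Polynomial.X + 2 + pE + pI + pP + pU with hq
  refine ⟨q * (2 * q + 1), fun n G hG H hH vs => ?_⟩
  have hn : 0 < n := Fin.pos_iff_nonempty.2 hG.nonempty
  set c := q.eval n with hc
  have hcv : c = n + 2 + pE.eval n + pI.eval n + pP.eval n + pU.eval n := by simp [hc, hq]
  have hτ : (q * (2 * q + 1)).eval n = c * (2 * c + 1) := by simp [hc]
  rw [hτ]
  have wE := hpE n
  have wI := hpI n
  have wP := hpP n
  have wU := hpU n
  rw [mem_mHalfspaces_iff hG] at hH
  obtain ⟨δ, e, R, hE⟩ := exists_goodExpert hG hH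
  set b := n + 1 + expertsE.weight n + initC.steps n with hb
  suffices h : ∃ s k, learner.Run G H (c * (2 * c + 1)) vs s k ∧
      Invariant G (H : Set (Fin n)) δ e R b k s by
    obtain ⟨s, k, hrun, hinv⟩ := h
    refine ⟨s, k, hrun, ?_⟩
    obtain ⟨M, -, hM2, hM3, hM4⟩ := hinv.mistakes
    have hMn : M.card ≤ n := by simpa using Finset.card_le_univ M
    refine mistakes_le hn (hE.card_le M hM2 hM3) (one_le_vcDim hG) hMn ?_
    refine le_trans (Nat.mul_le_mul_left _ ?_) hinv.potential
    rw [← hM4]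
    have hmem : e ∈ Finset.range (n ^ 4) := Finset.mem_range.2 hE.lt
    refine le_trans ?_ (Finset.single_le_sum (f := fun i => s.arr 3 i + s.arr 4 i)
      (fun _ _ => Nat.zero_le _) hmem)
    rcases hE.kind with rfl | rfl
    · exact Nat.le_add_right _ _
    · exact Nat.le_add_left _ _
  induction vs using List.reverseRecOn with
  | nil =>
    set s₀ := inputMemory G with hs₀
    have r0 : s₀.reg 0 = n := by simp [hs₀, inputMemory]
    have rx : ∀ x, x ≠ 0 → s₀.reg x = 0 := fun x hx => by simp [hs₀, inputMemory, hx]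
    have hbd := inputMemory_bounded G
    have hlin : expertsE.Linear := ⟨⟨⟨trivial, rfl⟩, rfl⟩, rfl⟩
    have hval : expertsE.eval s₀ = n ^ 4 := by simp only [expertsE, Expr.eval, r0]; ring
    have hlt := Expr.eval_lt r0 hbd expertsE hlin
    have hcost := Expr.cost_le (c := c) r0 hbd expertsE hlin (by omega)
    have hsize : (expertsE.eval s₀).size ≤ c :=
      Nat.size_le.2 (hlt.trans_le (Nat.pow_le_pow_right two_pos (by omega)))
    set s₁ := s₀.setReg 4 (expertsE.eval s₀) with hs₁
    have hbd₁ : s₁.Bounded (n + 1 + expertsE.weight n) := (hbd.mono (by omega)).setReg hlt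
    have hH₁ : Holds G s₁ := ⟨by simp [hs₁, Memory.setReg, r0], by simp [hs₁, Memory.setReg, hval], rfl⟩
    obtain ⟨hbd₂, t, ht, ht'⟩ := initC_tame.exec (c := c) hH₁.1 hH₁.2 hbd₁ (by omega)
    obtain ⟨i1, i2, i3⟩ := initC_run hH₁
    refine ⟨initC.run s₁, 0, .start (.seq (.assign s₀ 4 expertsE) ht) ?_, ?_⟩
    · have : (expertsE.weight n + 1 + initC.steps n) * (2 * c + 1) ≤ c * (2 * c + 1) :=
        Nat.mul_le_mul_right _ (by omega)
      refine le_trans ?_ this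
      simp only [add_mul, one_mul]
      omega
    · refine ⟨hH₁.run (by decide) (by decide) (by decide), fun x hx0 hx4 => ?_, hbd₂, fun v => .inl ?_, ?_,
        ⟨∅, by simp, by simp, by simp, ?_⟩⟩
      · rw [i3]
        split_ifs with hx
        · rfl
        · simp [hs₁, Memory.setReg, hx4, rx x hx0]
      · rw [i2]; simp [hs₁, hs₀, Memory.setReg, inputMemory]
      · rw [pow_zero, pow_zero, one_mul, one_mul, Finset.sum_congr rfl (g := fun _ => 2 ^ n + 2 ^ n)
          fun i hi => by rw [(i1 i (Finset.mem_range.1 hi)).1, (i1 i (Finset.mem_range.1 hi)).2]]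
        simp
      · rcases hE.kind with rfl | rfl
        · simpa using (i1 e hE.lt).1
        · simpa using (i1 e hE.lt).2
  | append_singleton vs v ih =>
    obtain ⟨s, k, hrun, hinv⟩ := ih
    have h0 : Holds G (s.setReg 1 v) := hinv.holds.setReg (by decide) (by decide)
    have hvb : (v : ℕ) < 2 ^ b :=
      (v.2.trans Nat.lt_two_pow_self).trans_le (Nat.pow_le_pow_right two_pos (by omega))
    obtain ⟨hbd₁, t, ht, ht'⟩ := predictC_tame.exec (c := c) h0.1 h0.2 (hinv.bounded.setReg hvb)
      (by omega)
    have h1 : Holds G (predictC.run (s.setReg 1 v)) := h0.run (by decide) (by decide) (by decide)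
    have h2 : Holds G ((predictC.run (s.setReg 1 v)).setReg 3 (label H v)) :=
      h1.setReg (by decide) (by decide)
    have hlab : label H v < 2 ^ (b + predictC.steps n) := by
      have : 1 < 2 ^ (b + predictC.steps n) := Nat.one_lt_two_pow (by omega)
      simp only [label]; split_ifs <;> omega
    obtain ⟨-, t', hu, hu'⟩ := updateC_tame.exec (c := c) h2.1 h2.2 (hbd₁.setReg hlab) (by omega)
    refine ⟨_, _, .round v hrun ht hu ?_, hinv.round hH hE (by omega) v⟩
    have : (predictC.steps n + updateC.steps n) * (2 * c + 1) ≤ c * (2 * c + 1) :=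
      Nat.mul_le_mul_right _ (by omega)
    rw [add_mul] at this
    omega

end Final

end MonoHalfspace

theorem mainTheorem12 :
    (∃ (A : MonoHalfspace.OnlineLearner) (p : Polynomial ℕ) (C : ℝ),
      ∀ (n : ℕ) (G : SimpleGraph (Fin n)), 2 ≤ n → G.Connected →
        A.LearnsHalfspaces G (p.eval n)
          (C * ((MonoHalfspace.mHalfspaces G).vcDim * Real.log n))) ∧
    (∃ (A : MonoHalfspace.OnlineLearner) (p : Polynomial ℕ) (C : ℝ),
      ∀ (n : ℕ) (G : SimpleGraph (Fin n)), G.Connected →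
        A.LearnsHalfspaces G (2 ^ (MonoHalfspace.mHalfspaces G).vcDim * p.eval n)
          (C * ((MonoHalfspace.mHalfspaces G).vcDim + Real.log n))) := by
  obtain ⟨p, hp⟩ := MonoHalfspace.learner_learnsHalfspaces
  refine ⟨⟨MonoHalfspace.learner, p, 48, fun n G hn hG H hH vs => ?_⟩,
    ⟨MonoHalfspace.learner, p, 16, fun n G hG H hH vs => ?_⟩⟩
  · obtain ⟨s, k, hrun, hk⟩ := hp n G hG H hH vs
    refine ⟨s, k, hrun, hk.trans ?_⟩
    -- Both `d` and `log n` are at most a constant multiple of `d * log n`.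
    have hd : (1 : ℝ) ≤ (MonoHalfspace.mHalfspaces G).vcDim := by
      exact_mod_cast MonoHalfspace.one_le_vcDim hG
    have hlog : (1 / 2 : ℝ) ≤ Real.log n := by
      have h1 : Real.log 2 ≤ Real.log n := Real.log_le_log (by norm_num) (by exact_mod_cast hn)
      have h2 := Real.log_two_gt_d9
      linarith
    nlinarith [mul_nonneg (sub_nonneg.2 hd) (sub_nonneg.2 hlog)]
  · obtain ⟨s, k, hrun, hk⟩ := hp n G hG H hH vs
    exact ⟨s, k, hrun.mono (Nat.le_mul_of_pos_left _ (by positivity)), hk⟩
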